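/- Let $T>0$, let $B=(B_t)_{0\le t\le T}$ be a $d$-dimensional Brownian motion on a probability space $(\Omega,\mathcal F,\mathbb P)$, and let $\mathbb F$ be the filtration generated by $B$ and completed by the $\mathbb P$-null sets of $\mathcal F$. Let $\mathcal S^2$ be the set of continuous $\mathbb F$-adapted real processes $Y$ on $[0,T]$ with $\mathbb E[\sup_{t\le T}|Y_t|^2]<\infty$, $\mathcal A^2$ the set of increasing processes $K\in\mathcal S^2$ with $K_0=0$, and $\mathcal M^{d,2}$ the set of (jointly measurable) $\mathbb F$-adapted $\mathbb R^d$-valued processes $Z$ with $\mathbb E\int_0^T|Z_s|^2ds<\infty$. Consider the system of reflected BSDEs with interconnected obstacles with data $\psi_1(t,\omega,y,z)=y$, $\psi_2(t,\omega,y,z)=2y$, $a=b=0$ and terminal values $\xi^1=\xi^2=1$: $\mathbb P$-a.s., for all $t\in[0,T]$, $$(\mathcal S_2)\quad\begin{cases} Y^1_t=1+\int_t^T Y^1_s\,ds+(K^1_T-K^1_t)-\int_t^T Z^1_s\,dB_s,\\ Y^2_t=1+\int_t^T 2Y^2_s\,ds-(K^2_T-K^2_t)-\int_t^T Z^2_s\,dB_s,\\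 Y^1_t\ge Y^2_t,\qquad \int_0^T(Y^1_s-Y^2_s)\,dK^1_s=\int_0^T(Y^1_s-Y^2_s)\,dK^2_s=0.\end{cases}$$ A solution is a 6-uplet $(Y^1,Z^1,K^1,Y^2,Z^2,K^2)$ satisfying $(\mathcal S_2)$ with $(Y^i,Z^i,K^i)\in\mathcal S^2\times\mathcal M^{d,2}\times\mathcal A^2$ for $i=1,2$. It is minimal (resp. maximal) if for every solution $(\tilde Y^1,\tilde Z^1,\tilde K^1,\tilde Y^2,\tilde Z^2,\tilde K^2)$ one has, $\mathbb P$-a.s., for all $t\le T$ and $i=1,2$, $\tilde Y^i_t\ge Y^i_t$ (resp. $\tilde Y^i_t\le Y^i_t$). Then, identifying indistinguishable processes $Y^i$, $K^i$ and $dt\otimes d\mathbb P$-a.e. equal processes $Z^i$: (i) $(\mathcal S_2)$ has exactly one minimal solution, and it is given, for $t\in[0,T]$, by $Y^1_t=Y^2_t=e^{T-t}$, $Z^1_t=Z^2_t=0$, $K^1_t=0$, $K^2_t=e^T(1-e^{-t})$. (ii) $(\mathcal S_2)$ has exactly one maximal solution, and it is given, for $t\in[0,T]$, by $Y^1_t=Y^2_t=e^{2(T-t)}$,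 $Z^1_t=Z^2_t=0$, $K^1_t=\tfrac12e^{2T}(1-e^{-2t})$, $K^2_t=0$. (iii) Hence uniqueness fails for $(\mathcal S_2)$: it has at least two solutions, and these differ in both $Y^1$ and $Y^2$ (neither component is indistinguishable from its counterpart). -/

import Mathlib

open MeasureTheory ProbabilityTheory Set Filter Topology

noncomputable section

/-- `B` is a standard `d`-dimensional Brownian motion on the time interval `[0, T]` under `P`
(only the values `B t` with `t ∈ [0, T]` matter). The increment `B t - B s` has independent
coordinates with law `N(0, t - s)` and is independent of the past up to time `s`. -/
structure IsBrownianMotionOn {Ω : Type*} [MeasurableSpace Ω] {d : ℕ} (P : Measure Ω) (T : ℝ)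
    (B : ℝ → Ω → EuclideanSpace ℝ (Fin d)) : Prop where
  measurable : ∀ t ∈ Icc 0 T, Measurable (B t)
  start : ∀ᵐ ω ∂P, B 0 ω = 0
  continuous_paths : ∀ᵐ ω ∂P, ContinuousOn (fun t => B t ω) (Icc 0 T)
  increment_law : ∀ s t : ℝ, 0 ≤ s → s ≤ t → t ≤ T →
    P.map (fun ω => WithLp.ofLp (B t ω - B s ω)) =
      Measure.pi (fun _ : Fin d => gaussianReal 0 (t - s).toNNReal)
  increment_indep : ∀ s t : ℝ, 0 ≤ s → s ≤ t → t ≤ T →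
    Indep (⨆ r ∈ Icc 0 s, MeasurableSpace.comap (B r) inferInstance)
      (MeasurableSpace.comap (fun ω => B t ω - B s ω) inferInstance) P

/-- The filtration generated by `B`, completed by the `P`-null sets. -/
abbrev brownianFiltration {Ω : Type*} [MeasurableSpace Ω] {d : ℕ} (P : Measure Ω)
    (B : ℝ → Ω → EuclideanSpace ℝ (Fin d)) (t : ℝ) : MeasurableSpace Ω :=
  (⨆ s ∈ Icc 0 t, MeasurableSpace.comap (B s) inferInstance) ⊔
    MeasurableSpace.generateFrom {N : Set Ω | MeasurableSet N ∧ P N = 0}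

/-- `X` is adapted on `[0, T]` to the completed filtration of `B`. -/
def IsAdaptedOn {Ω : Type*} [MeasurableSpace Ω] {d : ℕ} {E : Type*} [MeasurableSpace E]
    (P : Measure Ω) (T : ℝ) (B : ℝ → Ω → EuclideanSpace ℝ (Fin d)) (X : ℝ → Ω → E) : Prop :=
  ∀ t ∈ Icc 0 T, Measurable[brownianFiltration P B t] (X t)

/-- The measure `dt ⊗ dP` on `[0, T] × Ω`. -/
def timeProd {Ω : Type*} [MeasurableSpace Ω] (P : Measure Ω) (T : ℝ) : Measure (ℝ × Ω) :=
  (volume.restrict (Icc 0 T)).prod P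

/-- The space `𝒮²`: continuous adapted processes with `E[sup_{t ≤ T} |Y_t|²] < ∞`. -/
structure MemS2 {Ω : Type*} [MeasurableSpace Ω] {d : ℕ} (P : Measure Ω) (T : ℝ)
    (B : ℝ → Ω → EuclideanSpace ℝ (Fin d)) (Y : ℝ → Ω → ℝ) : Prop where
  adapted : IsAdaptedOn P T B Y
  continuous_paths : ∀ᵐ ω ∂P, ContinuousOn (fun t => Y t ω) (Icc 0 T)
  sup_sq : ∫⁻ ω, (⨆ t ∈ Icc 0 T, ‖Y t ω‖ₑ ^ 2) ∂P < ⊤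

/-- The space `𝒜²`: increasing processes of `𝒮²` that start at `0`. -/
structure MemA2 {Ω : Type*} [MeasurableSpace Ω] {d : ℕ} (P : Measure Ω) (T : ℝ)
    (B : ℝ → Ω → EuclideanSpace ℝ (Fin d)) (K : ℝ → Ω → ℝ) : Prop extends MemS2 P T B K where
  monotone_paths : ∀ᵐ ω ∂P, MonotoneOn (fun t => K t ω) (Icc 0 T)
  start : ∀ᵐ ω ∂P, K 0 ω = 0

/-- The space `ℳ^{d,2}`: (jointly measurable) adapted processes with
`E[∫₀ᵀ |Z_s|² ds] < ∞`. -/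
structure MemM2 {Ω : Type*} [MeasurableSpace Ω] {d : ℕ} (P : Measure Ω) (T : ℝ)
    (B : ℝ → Ω → EuclideanSpace ℝ (Fin d)) (Z : ℝ → Ω → EuclideanSpace ℝ (Fin d)) : Prop where
  adapted : IsAdaptedOn P T B Z
  memLp : MemLp (fun p : ℝ × Ω => Z p.1 p.2) 2 (timeProd P T)

/-- A simple integrand `∑_{i < n} η_i 1_{(t_i, t_{i+1}]}` on `[0, T]`, where `η_i` is bounded and
measurable with respect to the completed Brownian filtration at time `t_i`. -/
structure SimpleIntegrand {Ω : Type*} [MeasurableSpace Ω] {d : ℕ} (P : Measure Ω) (T : ℝ)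
    (B : ℝ → Ω → EuclideanSpace ℝ (Fin d)) where
  n : ℕ
  time : ℕ → ℝ
  coeff : ℕ → Ω → EuclideanSpace ℝ (Fin d)
  time_mono : Monotone time
  time_mem : ∀ i, time i ∈ Icc 0 T
  coeff_measurable : ∀ i, Measurable[brownianFiltration P B (time i)] (coeff i)
  coeff_bounded : ∃ C : ℝ, ∀ i ω, ‖coeff i ω‖ ≤ C

/-- The process defined by a simple integrand. -/
def SimpleIntegrand.eval {Ω : Type*} [MeasurableSpace Ω] {d : ℕ} {P : Measure Ω} {T : ℝ}
    {B : ℝ → Ω → EuclideanSpace ℝ (Fin d)} (H : SimpleIntegrand P T B) (s : ℝ) (ω : Ω) :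
    EuclideanSpace ℝ (Fin d) :=
  ∑ i ∈ Finset.range H.n, (Ioc (H.time i) (H.time (i + 1))).indicator (fun _ => H.coeff i ω) s

/-- The elementary stochastic integral `∑_i ⟨η_i, B_{t_{i+1} ∧ t} - B_{t_i ∧ t}⟩`. -/
def SimpleIntegrand.integral {Ω : Type*} [MeasurableSpace Ω] {d : ℕ} {P : Measure Ω} {T : ℝ}
    {B : ℝ → Ω → EuclideanSpace ℝ (Fin d)} (H : SimpleIntegrand P T B) (t : ℝ) (ω : Ω) : ℝ :=
  ∑ i ∈ Finset.range H.n,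
    inner ℝ (H.coeff i ω) (B (min (H.time (i + 1)) t) ω - B (min (H.time i) t) ω)

/-- `I` is (a continuous adapted version of) the Itô integral process `t ↦ ∫₀ᵗ Z_s dB_s`,
`t ∈ [0, T]`: for some simple integrands `Hₙ → Z` in `L²(dt ⊗ dP)`, the elementary integrals
of the `Hₙ` up to time `t` converge to `I t` in `L²(P)`, for every `t ∈ [0, T]`. -/
structure IsItoIntegral {Ω : Type*} [MeasurableSpace Ω] {d : ℕ} (P : Measure Ω) (T : ℝ)
    (B : ℝ → Ω → EuclideanSpace ℝ (Fin d)) (Z : ℝ → Ω → EuclideanSpace ℝ (Fin d))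
    (I : ℝ → Ω → ℝ) : Prop where
  adapted : IsAdaptedOn P T B I
  continuous_paths : ∀ᵐ ω ∂P, ContinuousOn (fun t => I t ω) (Icc 0 T)
  approx : ∃ H : ℕ → SimpleIntegrand P T B,
    Tendsto (fun n => eLpNorm (fun p : ℝ × Ω => (H n).eval p.1 p.2 - Z p.1 p.2) 2 (timeProd P T))
      atTop (𝓝 0) ∧
    ∀ t ∈ Icc 0 T,
      Tendsto (fun n => eLpNorm (fun ω => (H n).integral t ω - I t ω) 2 P) atTop (𝓝 0)

/-- `∫₀ᵀ f dk = 0`, as a Lebesgue-Stieltjes integral, for a path `k` that is increasing and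
right-continuous on `[0, T]`. On `(0, T]` the measure of `κ` is determined by `k`. -/
def StieltjesIntegralEqZero (T : ℝ) (f k : ℝ → ℝ) : Prop :=
  ∃ κ : StieltjesFunction ℝ, (∀ t ∈ Icc 0 T, κ t = k t) ∧
    IntegrableOn f (Ioc 0 T) κ.measure ∧ ∫ s in Ioc 0 T, f s ∂κ.measure = 0

/-- The data `(ψ₁, ψ₂, ξ¹, ξ², a, b)` of a system of reflected BSDEs with interconnected
obstacles. -/
structure SystemData (Ω : Type*) (d : ℕ) where
  ψ₁ : ℝ → Ω → ℝ → EuclideanSpace ℝ (Fin d) → ℝ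
  ψ₂ : ℝ → Ω → ℝ → EuclideanSpace ℝ (Fin d) → ℝ
  ξ₁ : Ω → ℝ
  ξ₂ : Ω → ℝ
  a : ℝ → Ω → ℝ
  b : ℝ → Ω → ℝ

/-- A 6-uplet of processes `(Y¹, Z¹, K¹, Y², Z², K²)`. -/
structure Sextuple (Ω : Type*) (d : ℕ) where
  Y₁ : ℝ → Ω → ℝ
  Z₁ : ℝ → Ω → EuclideanSpace ℝ (Fin d)
  K₁ : ℝ → Ω → ℝ
  Y₂ : ℝ → Ω → ℝ
  Z₂ : ℝ → Ω → EuclideanSpace ℝ (Fin d)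
  K₂ : ℝ → Ω → ℝ

/-- `S` is a solution of the system `(𝒮)` with data `D`. -/
structure IsSolution {Ω : Type*} [MeasurableSpace Ω] {d : ℕ} (P : Measure Ω) (T : ℝ)
    (B : ℝ → Ω → EuclideanSpace ℝ (Fin d)) (D : SystemData Ω d) (S : Sextuple Ω d) : Prop where
  memY₁ : MemS2 P T B S.Y₁
  memZ₁ : MemM2 P T B S.Z₁
  memK₁ : MemA2 P T B S.K₁
  memY₂ : MemS2 P T B S.Y₂
  memZ₂ : MemM2 P T B S.Z₂
  memK₂ : MemA2 P T B S.K₂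
  drift₁ : ∀ᵐ ω ∂P, IntervalIntegrable (fun s => D.ψ₁ s ω (S.Y₁ s ω) (S.Z₁ s ω)) volume 0 T
  drift₂ : ∀ᵐ ω ∂P, IntervalIntegrable (fun s => D.ψ₂ s ω (S.Y₂ s ω) (S.Z₂ s ω)) volume 0 T
  eq₁ : ∃ I : ℝ → Ω → ℝ, IsItoIntegral P T B S.Z₁ I ∧ ∀ᵐ ω ∂P, ∀ t ∈ Icc 0 T,
    S.Y₁ t ω = D.ξ₁ ω + (∫ s in t..T, D.ψ₁ s ω (S.Y₁ s ω) (S.Z₁ s ω))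
      + (S.K₁ T ω - S.K₁ t ω) - (I T ω - I t ω)
  eq₂ : ∃ I : ℝ → Ω → ℝ, IsItoIntegral P T B S.Z₂ I ∧ ∀ᵐ ω ∂P, ∀ t ∈ Icc 0 T,
    S.Y₂ t ω = D.ξ₂ ω + (∫ s in t..T, D.ψ₂ s ω (S.Y₂ s ω) (S.Z₂ s ω))
      - (S.K₂ T ω - S.K₂ t ω) - (I T ω - I t ω)
  obstacle₁ : ∀ᵐ ω ∂P, ∀ t ∈ Icc 0 T, S.Y₂ t ω - D.a t ω ≤ S.Y₁ t ω
  obstacle₂ : ∀ᵐ ω ∂P, ∀ t ∈ Icc 0 T, S.Y₂ t ω ≤ S.Y₁ t ω + D.b t ω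
  skorokhod₁ : ∀ᵐ ω ∂P, StieltjesIntegralEqZero T
    (fun s => S.Y₁ s ω - (S.Y₂ s ω - D.a s ω)) (fun s => S.K₁ s ω)
  skorokhod₂ : ∀ᵐ ω ∂P, StieltjesIntegralEqZero T
    (fun s => S.Y₁ s ω + D.b s ω - S.Y₂ s ω) (fun s => S.K₂ s ω)

/-- A minimal solution: a solution whose `Y`-components lie below those of every solution. -/
def IsMinimalSolution {Ω : Type*} [MeasurableSpace Ω] {d : ℕ} (P : Measure Ω) (T : ℝ)
    (B : ℝ → Ω → EuclideanSpace ℝ (Fin d)) (D : SystemData Ω d) (S : Sextuple Ω d) : Prop :=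
  IsSolution P T B D S ∧ ∀ S' : Sextuple Ω d, IsSolution P T B D S' →
    ∀ᵐ ω ∂P, ∀ t ∈ Icc 0 T, S.Y₁ t ω ≤ S'.Y₁ t ω ∧ S.Y₂ t ω ≤ S'.Y₂ t ω

/-- A maximal solution: a solution whose `Y`-components lie above those of every solution. -/
def IsMaximalSolution {Ω : Type*} [MeasurableSpace Ω] {d : ℕ} (P : Measure Ω) (T : ℝ)
    (B : ℝ → Ω → EuclideanSpace ℝ (Fin d)) (D : SystemData Ω d) (S : Sextuple Ω d) : Prop :=
  IsSolution P T B D S ∧ ∀ S' : Sextuple Ω d, IsSolution P T B D S' →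
    ∀ᵐ ω ∂P, ∀ t ∈ Icc 0 T, S'.Y₁ t ω ≤ S.Y₁ t ω ∧ S'.Y₂ t ω ≤ S.Y₂ t ω

/-- Two processes are indistinguishable on `[0, T]`. -/
def IndistOn {Ω : Type*} [MeasurableSpace Ω] (P : Measure Ω) (T : ℝ) (X X' : ℝ → Ω → ℝ) : Prop :=
  ∀ᵐ ω ∂P, ∀ t ∈ Icc 0 T, X t ω = X' t ω

/-- Equality of 6-uplets: `Y` and `K` up to indistinguishability, `Z` up to `dt ⊗ dP`-null sets. -/
structure SameSextuple {Ω : Type*} [MeasurableSpace Ω] {d : ℕ} (P : Measure Ω) (T : ℝ)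
    (S S' : Sextuple Ω d) : Prop where
  eqY₁ : IndistOn P T S.Y₁ S'.Y₁
  eqZ₁ : ∀ᵐ p ∂(timeProd P T), S.Z₁ p.1 p.2 = S'.Z₁ p.1 p.2
  eqK₁ : IndistOn P T S.K₁ S'.K₁
  eqY₂ : IndistOn P T S.Y₂ S'.Y₂
  eqZ₂ : ∀ᵐ p ∂(timeProd P T), S.Z₂ p.1 p.2 = S'.Z₂ p.1 p.2
  eqK₂ : IndistOn P T S.K₂ S'.K₂

/-- The data of the system `(𝒮₂)`: `ψ₁ = y`, `ψ₂ = 2y`, `ξ¹ = ξ² = 1`, `a = b = 0`. -/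
def dataS2 (Ω : Type*) (d : ℕ) : SystemData Ω d where
  ψ₁ := fun _ _ y _ => y
  ψ₂ := fun _ _ y _ => 2 * y
  ξ₁ := fun _ => 1
  ξ₂ := fun _ => 1
  a := fun _ _ => 0
  b := fun _ _ => 0

/-- `Y¹ = Y² = e^{T-t}`, `Z¹ = Z² = 0`, `K¹ = 0`, `K² = e^T (1 - e^{-t})`. -/
def solMin (Ω : Type*) (d : ℕ) (T : ℝ) : Sextuple Ω d where
  Y₁ := fun t _ => Real.exp (T - t)
  Z₁ := fun _ _ => 0
  K₁ := fun _ _ => 0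
  Y₂ := fun t _ => Real.exp (T - t)
  Z₂ := fun _ _ => 0
  K₂ := fun t _ => Real.exp T * (1 - Real.exp (-t))

/-- `Y¹ = Y² = e^{2(T-t)}`, `Z¹ = Z² = 0`, `K¹ = ½ e^{2T} (1 - e^{-2t})`, `K² = 0`. -/
def solMax (Ω : Type*) (d : ℕ) (T : ℝ) : Sextuple Ω d where
  Y₁ := fun t _ => Real.exp (2 * (T - t))
  Z₁ := fun _ _ => 0
  K₁ := fun t _ => 1 / 2 * Real.exp (2 * T) * (1 - Real.exp (-2 * t))
  Y₂ := fun t _ => Real.exp (2 * (T - t))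
  Z₂ := fun _ _ => 0
  K₂ := fun _ _ => 0

end

/-! ### Brownian increments against the completed past. -/

section BrownianIncrements

variable {Ω : Type*} [mΩ : MeasurableSpace Ω] {d : ℕ} {P : Measure Ω} {T : ℝ}
  {B : ℝ → Ω → EuclideanSpace ℝ (Fin d)}

/-! Every solution is trapped: e^{T-t} ≤ Y² ≤ Y¹ ≤ e^{2(T-t)}. The first and last expressions solve
the linear equations with drifts y and 2y, and each is attained by both components of an explicit
solution. So the minimal and maximal solutions are read off from the trap.

Two bounds use only the sign of the reflection. K¹ pushes Y¹ up, so Y¹ dominates the unreflected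
e^{T-t}; K² pushes Y² down, so Y² stays below e^{2(T-t)}. The other two use the Skorokhod condition.
Where Y² < e^{T-t} ≤ Y¹ the obstacle is not touched, so K² is flat and cannot hold Y² down, while
the drift 2y exceeds y; hence Y² ≥ e^{T-t}. Symmetrically, where Y¹ > e^{2(T-t)} ≥ Y², K¹ is flat,
and Y¹ ≤ e^{2(T-t)}.

All four are instances of `ae_nonpos_of_le_increments`. It avoids Itô's formula: v(t) = E[D_t⁺] is
estimated over small steps by restricting to the event D_s > 0, which is known at time s and removes
the martingale term. The reflection terms vanish as the mesh shrinks, and a backward Gronwall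
inequality gives v = 0. Flatness at a uniform scale comes from
`StieltjesIntegralEqZero.exists_flat`, after lowering the barrier by ε.

Uniqueness of Z and K: once Y is exponential, the stochastic integral has finite variation, hence
vanishes (`IsItoIntegral.ae_eq_zero_of_finite_variation`). The isometry then gives Z = 0, and the
equation determines K. -/

theorem brownianFiltration_le (hB : IsBrownianMotionOn P T B) {t : ℝ} (ht : t ≤ T) :
    brownianFiltration P B t ≤ mΩ := by
  refine sup_le (iSup₂_le fun s hs => ?_) (MeasurableSpace.generateFrom_le fun N hN => hN.1)
  exact (hB.measurable s ⟨hs.1, hs.2.trans ht⟩).comap_le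

theorem brownianFiltration_mono {s t : ℝ} (h : s ≤ t) :
    brownianFiltration P B s ≤ brownianFiltration P B t :=
  sup_le_sup_right (biSup_mono fun _ hr => ⟨hr.1, hr.2.trans h⟩) _

theorem measurable_brownianFiltration {s t : ℝ} (hs : 0 ≤ s) (hst : s ≤ t) :
    Measurable[brownianFiltration P B t] (B s) :=
  Measurable.of_comap_le ((le_iSup₂ (f := fun r (_ : r ∈ Icc 0 t) =>
    MeasurableSpace.comap (B r) inferInstance) s ⟨hs, hst⟩).trans le_sup_left)

theorem IsBrownianMotionOn.measurable_increment (hB : IsBrownianMotionOn P T B) {s t : ℝ}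
    (hs : 0 ≤ s) (hst : s ≤ t) (ht : t ≤ T) : Measurable fun ω => B t ω - B s ω :=
  (hB.measurable t ⟨hs.trans hst, ht⟩).sub (hB.measurable s ⟨hs, hst.trans ht⟩)

theorem IsBrownianMotionOn.measurable_increment_apply (hB : IsBrownianMotionOn P T B) {s t : ℝ}
    (hs : 0 ≤ s) (hst : s ≤ t) (ht : t ≤ T) (k : Fin d) :
    Measurable fun ω => (B t ω - B s ω) k :=
  Measurable.comp (g := fun x : EuclideanSpace ℝ (Fin d) => x k) (by fun_prop)
    (hB.measurable_increment hs hst ht)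

/-- Completion does not affect independence: each event of the completed past agrees almost
everywhere with an event of the raw past, so the probabilities in the product formula are unchanged.
-/
theorem IsBrownianMotionOn.indep_brownianFiltration (hB : IsBrownianMotionOn P T B) {s t : ℝ}
    (hs : 0 ≤ s) (hst : s ≤ t) (ht : t ≤ T) :
    Indep (brownianFiltration P B s)
      (MeasurableSpace.comap (fun ω => B t ω - B s ω) inferInstance) P := by
  have key : brownianFiltration P B s ≤ eventuallyMeasurableSpace
      (⨆ r ∈ Icc 0 s, MeasurableSpace.comap (B r) inferInstance) (ae P) := by
    refine sup_le (fun A hA => ⟨A, hA, ae_eq_refl A⟩) (MeasurableSpace.generateFrom_le fun N hN => ?_)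
    exact ⟨∅, MeasurableSpace.measurableSet_empty _, ae_eq_empty.2 hN.2⟩
  rw [Indep_iff]
  intro A C hA hC
  obtain ⟨A', hA', hAA'⟩ := key A hA
  rw [measure_congr (hAA'.inter (ae_eq_refl C)), measure_congr hAA']
  exact (Indep_iff _ _ _).1 (hB.increment_indep s t hs hst ht) A' C hA' hC

theorem IsBrownianMotionOn.map_increment_apply (hB : IsBrownianMotionOn P T B) {s t : ℝ}
    (hs : 0 ≤ s) (hst : s ≤ t) (ht : t ≤ T) (k : Fin d) :
    P.map (fun ω => (B t ω - B s ω) k) = gaussianReal 0 (t - s).toNNReal := by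
  have h := hB.increment_law s t hs hst ht
  have hm := hB.measurable_increment hs hst ht
  rw [← (measurePreserving_eval (fun _ : Fin d => gaussianReal 0 (t - s).toNNReal) k).map_eq, ← h,
    Measure.map_map (measurable_pi_apply k) (by fun_prop)]
  rfl

theorem IsBrownianMotionOn.memLp_increment_apply (hB : IsBrownianMotionOn P T B) {s t : ℝ}
    (hs : 0 ≤ s) (hst : s ≤ t) (ht : t ≤ T) (k : Fin d) :
    MemLp (fun ω => (B t ω - B s ω) k) 2 P := by
  have hm := hB.measurable_increment_apply hs hst ht
  have h := memLp_id_gaussianReal' (μ := 0) (v := (t - s).toNNReal) 2 (by simp)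
  rw [← hB.map_increment_apply hs hst ht k] at h
  exact (memLp_map_measure_iff aestronglyMeasurable_id (hm k).aemeasurable).1 h

theorem IsBrownianMotionOn.integral_increment_apply (hB : IsBrownianMotionOn P T B) {s t : ℝ}
    (hs : 0 ≤ s) (hst : s ≤ t) (ht : t ≤ T) (k : Fin d) :
    ∫ ω, (B t ω - B s ω) k ∂P = 0 := by
  have hm := hB.measurable_increment_apply hs hst ht
  have h := integral_id_gaussianReal (μ := 0) (v := (t - s).toNNReal)
  rw [← hB.map_increment_apply hs hst ht k, integral_map (hm k).aemeasurable (by fun_prop)] at h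
  exact h

theorem IsBrownianMotionOn.integral_increment_apply_mul (hB : IsBrownianMotionOn P T B)
    [IsProbabilityMeasure P] {s t : ℝ}
    (hs : 0 ≤ s) (hst : s ≤ t) (ht : t ≤ T) (k l : Fin d) :
    ∫ ω, (B t ω - B s ω) k * (B t ω - B s ω) l ∂P = if k = l then t - s else 0 := by
  have hm := hB.measurable_increment_apply hs hst ht
  split_ifs with hkl
  · subst hkl
    have h := variance_fun_id_gaussianReal (μ := 0) (v := (t - s).toNNReal)
    rw [← hB.map_increment_apply hs hst ht k, variance_map (by fun_prop) (hm k).aemeasurable]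
      at h
    change Var[fun ω => (B t ω - B s ω) k; P] = _ at h
    rw [
      variance_of_integral_eq_zero (hm k).aemeasurable (hB.integral_increment_apply hs hst ht k)] at h
    rw [Real.coe_toNNReal _ (sub_nonneg.2 hst)] at h
    rw [← h]
    refine integral_congr_ae (ae_of_all _ fun ω => ?_)
    simp [pow_two]
  · have hind : iIndepFun (fun (i : Fin d) ω => (B t ω - B s ω) i) P := by
      rw [iIndepFun_iff_map_fun_eq_pi_map (fun i => (hm i).aemeasurable)]
      simp_rw [hB.map_increment_apply hs hst ht]
      exact hB.increment_law s t hs hst ht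
    rw [(hind.indepFun hkl).integral_fun_mul_eq_mul_integral (hm k).aestronglyMeasurable
      (hm l).aestronglyMeasurable,
      hB.integral_increment_apply hs hst ht k, zero_mul]

theorem IsBrownianMotionOn.indepFun_increment_apply (hB : IsBrownianMotionOn P T B) {s t : ℝ}
    (hs : 0 ≤ s) (hst : s ≤ t) (ht : t ≤ T) {E : Type*} [MeasurableSpace E] {U : Ω → E}
    (hU : Measurable[brownianFiltration P B s] U) :
    IndepFun U (fun ω => B t ω - B s ω) P := by
  rw [IndepFun_iff_Indep]
  exact indep_of_indep_of_le_left (hB.indep_brownianFiltration hs hst ht) hU.comap_le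

/-- Coordinatewise, a product of independent integrable variables is integrable with product mean.
Only integrability of `U` is assumed because the coefficients used later contain earlier increments
or square integrable weights, which are unbounded. -/
theorem IsBrownianMotionOn.integrable_inner_increment (hB : IsBrownianMotionOn P T B) {s t : ℝ}
    (hs : 0 ≤ s) (hst : s ≤ t) (ht : t ≤ T) [IsProbabilityMeasure P]
    {U : Ω → EuclideanSpace ℝ (Fin d)}
    (hU : Measurable[brownianFiltration P B s] U) (hUi : Integrable U P) :
    Integrable (fun ω => inner ℝ (U ω) (B t ω - B s ω)) P ∧
      ∫ ω, inner ℝ (U ω) (B t ω - B s ω) ∂P = 0 := by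
  have hm := hB.measurable_increment_apply hs hst ht
  have hind := hB.indepFun_increment_apply hs hst ht hU
  have hindk : ∀ k : Fin d, IndepFun (fun ω => U ω k) (fun ω => (B t ω - B s ω) k) P := fun k =>
    hind.comp (φ := fun x : EuclideanSpace ℝ (Fin d) => x k)
      (ψ := fun x : EuclideanSpace ℝ (Fin d) => x k) (by fun_prop) (by fun_prop)
  have hUk : ∀ k : Fin d, Integrable (fun ω => U ω k) P := fun k =>
    hUi.mono (Measurable.comp (g := fun x : EuclideanSpace ℝ (Fin d) => x k) (by fun_prop)
      (hU.mono (brownianFiltration_le hB (hst.trans ht)) le_rfl)).aestronglyMeasurable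
      (ae_of_all _ fun ω => PiLp.norm_apply_le (U ω) k)
  have hi : ∀ k : Fin d, Integrable (fun ω => U ω k * (B t ω - B s ω) k) P := fun k =>
    (hindk k).integrable_mul (hUk k) ((hB.memLp_increment_apply hs hst ht k).integrable (by simp))
  have he : (fun ω => inner ℝ (U ω) (B t ω - B s ω)) =
      fun ω => ∑ k, U ω k * (B t ω - B s ω) k := by
    ext ω
    simp only [PiLp.inner_apply, RCLike.inner_apply, conj_trivial]
    exact Finset.sum_congr rfl fun k _ => mul_comm _ _
  rw [he]
  refine ⟨integrable_finsetSum _ fun k _ => hi k, ?_⟩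
  rw [integral_finsetSum _ fun k _ => hi k]
  refine Finset.sum_eq_zero fun k _ => ?_
  rw [(hindk k).integral_fun_mul_eq_mul_integral (hUk k).aestronglyMeasurable (hm k).aestronglyMeasurable,
    hB.integral_increment_apply hs hst ht k, mul_zero]

/-- One-step Itô isometry. The square expands into a double sum over coordinates; independence from
the past factors each term, and the covariance of the increment is (t - s) times the identity. -/
theorem IsBrownianMotionOn.integral_inner_increment_sq (hB : IsBrownianMotionOn P T B) {s t : ℝ}
    (hs : 0 ≤ s) (hst : s ≤ t) (ht : t ≤ T) [IsProbabilityMeasure P]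
    {U : Ω → EuclideanSpace ℝ (Fin d)}
    (hU : Measurable[brownianFiltration P B s] U) {C : ℝ} (hC : ∀ ω, ‖U ω‖ ≤ C) :
    MemLp (fun ω => inner ℝ (U ω) (B t ω - B s ω)) 2 P ∧
      ∫ ω, inner ℝ (U ω) (B t ω - B s ω) ^ 2 ∂P = (t - s) * ∫ ω, ‖U ω‖ ^ 2 ∂P := by
  have hm := hB.measurable_increment_apply hs hst ht
  have hUm : Measurable U := hU.mono (brownianFiltration_le hB (hst.trans ht)) le_rfl
  have hind := hB.indepFun_increment_apply hs hst ht hU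
  have hUkm : ∀ k, Measurable fun ω => U ω k := fun k =>
    Measurable.comp (g := fun x : EuclideanSpace ℝ (Fin d) => x k) (by fun_prop) hUm
  have hUk : ∀ k ω, ‖U ω k‖ ≤ C := fun k ω => (PiLp.norm_apply_le (U ω) k).trans (hC ω)
  have hUU : ∀ k l, Integrable (fun ω => U ω k * U ω l) P := fun k l =>
    Integrable.of_bound ((hUkm k).mul (hUkm l)).aestronglyMeasurable (C * C) (ae_of_all _ fun ω => by
      rw [norm_mul]
      exact mul_le_mul (hUk k ω) (hUk l ω) (norm_nonneg _) ((norm_nonneg _).trans (hC ω)))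
  have hBk := hB.memLp_increment_apply hs hst ht
  have hBB : ∀ k l, Integrable (fun ω => (B t ω - B s ω) k * (B t ω - B s ω) l) P := fun k l =>
    (hBk k).integrable_mul (hBk l)
  have hindk : ∀ k l : Fin d, IndepFun (fun ω => U ω k * U ω l)
      (fun ω => (B t ω - B s ω) k * (B t ω - B s ω) l) P := fun k l =>
    hind.comp (φ := fun x : EuclideanSpace ℝ (Fin d) => x k * x l)
      (ψ := fun x : EuclideanSpace ℝ (Fin d) => x k * x l) (by fun_prop) (by fun_prop)
  have he : ∀ ω, inner ℝ (U ω) (B t ω - B s ω) = ∑ k, U ω k * (B t ω - B s ω) k := by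
    intro ω
    simp only [PiLp.inner_apply, RCLike.inner_apply, conj_trivial]
    exact Finset.sum_congr rfl fun k _ => mul_comm _ _
  constructor
  · have hk : ∀ k, MemLp (fun ω => U ω k * (B t ω - B s ω) k) 2 P := fun k =>
      MemLp.of_le_mul (c := C) (hBk k) ((hUkm k).mul (hm k)).aestronglyMeasurable
        (ae_of_all _ fun ω => by
          rw [norm_mul]
          exact mul_le_mul_of_nonneg_right (hUk k ω) (norm_nonneg _))
    simp_rw [he]
    exact memLp_finsetSum _ fun k _ => hk k
  · have hsq : ∀ ω, inner ℝ (U ω) (B t ω - B s ω) ^ 2 =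
        ∑ k, ∑ l, (U ω k * U ω l) * ((B t ω - B s ω) k * (B t ω - B s ω) l) := by
      intro ω
      rw [he, pow_two, Finset.sum_mul_sum]
      exact Finset.sum_congr rfl fun k _ => Finset.sum_congr rfl fun l _ => by ring
    have hi : ∀ k l, Integrable
        (fun ω => (U ω k * U ω l) * ((B t ω - B s ω) k * (B t ω - B s ω) l)) P := fun k l =>
      (hindk k l).integrable_mul (hUU k l) (hBB k l)
    simp_rw [hsq]
    rw [integral_finsetSum _ fun k _ => integrable_finsetSum _ fun l _ => hi k l]
    simp_rw [EuclideanSpace.norm_sq_eq]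
    rw [integral_finsetSum _ fun k _ => by simpa [pow_two] using hUU k k, Finset.mul_sum]
    refine Finset.sum_congr rfl fun k _ => ?_
    rw [integral_finsetSum _ fun l _ => hi k l, Finset.sum_eq_single k]
    · rw [(hindk k k).integral_fun_mul_eq_mul_integral (hUU k k).aestronglyMeasurable
        (hBB k k).aestronglyMeasurable, hB.integral_increment_apply_mul hs hst ht, if_pos rfl,
        mul_comm]
      simp [pow_two]
    · intro l _ hl
      rw [(hindk k l).integral_fun_mul_eq_mul_integral (hUU k l).aestronglyMeasurable
        (hBB k l).aestronglyMeasurable, hB.integral_increment_apply_mul hs hst ht,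
        if_neg hl.symm, mul_zero]
    · simp

end BrownianIncrements

/-! ### Martingale property and isometry of the Itô integral. -/

section ItoIntegral

theorem integral_sq_sum_of_orthogonal {Ω : Type*} [MeasurableSpace Ω] {P : Measure Ω}
    (f : ℕ → Ω → ℝ) (n : ℕ) (hf : ∀ i < n, MemLp (f i) 2 P)
    (h : ∀ i j, i < j → j < n → ∫ ω, f i ω * f j ω ∂P = 0) :
    ∫ ω, (∑ i ∈ Finset.range n, f i ω) ^ 2 ∂P = ∑ i ∈ Finset.range n, ∫ ω, f i ω ^ 2 ∂P := by
  induction n with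
  | zero => simp
  | succ n ih =>
    have hS : MemLp (fun ω => ∑ i ∈ Finset.range n, f i ω) 2 P :=
      memLp_finsetSum _ fun i hi => hf i (by simp at hi; omega)
    have hn := hf n (Nat.lt_succ_self n)
    have hmul : ∀ i ∈ Finset.range n, Integrable (fun ω => f i ω * f n ω) P := fun i hi =>
      (hf i (by simp at hi; omega)).integrable_mul hn
    have he : ∀ ω, (∑ i ∈ Finset.range (n + 1), f i ω) ^ 2 =
        (∑ i ∈ Finset.range n, f i ω) ^ 2 + 2 * ∑ i ∈ Finset.range n, f i ω * f n ω
          + f n ω ^ 2 := by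
      intro ω
      rw [Finset.sum_range_succ, ← Finset.sum_mul]
      ring
    have hsum : Integrable (fun ω => (∑ i ∈ Finset.range n, f i ω) ^ 2 +
        2 * ∑ i ∈ Finset.range n, f i ω * f n ω) P :=
      hS.integrable_sq.add ((integrable_finsetSum _ hmul).const_mul 2)
    simp_rw [he]
    rw [integral_add hsum hn.integrable_sq, integral_add hS.integrable_sq ((integrable_finsetSum _ hmul).const_mul 2),
      integral_const_mul, integral_finsetSum _ hmul, Finset.sum_range_succ,
      ih (fun i hi => hf i (by omega)) (fun i j hij hj => h i j hij (by omega)),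
      Finset.sum_eq_zero (fun i hi => h i n (by simpa using hi) (Nat.lt_succ_self n))]
    ring

theorem eLpNorm_two_sq {α E : Type*} [MeasurableSpace α] [NormedAddCommGroup E] (μ : Measure α)
    (f : α → E) : eLpNorm f 2 μ ^ 2 = ∫⁻ x, ‖f x‖ₑ ^ 2 ∂μ := by
  have h := eLpNorm_nnreal_pow_eq_lintegral (f := f) (μ := μ) (p := 2) (by norm_num)
  simpa using h

theorem eLpNorm_two_sq_eq_ofReal_integral {α : Type*} [MeasurableSpace α] {μ : Measure α}
    {f : α → ℝ} (hf : MemLp f 2 μ) :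
    eLpNorm f 2 μ ^ 2 = ENNReal.ofReal (∫ x, f x ^ 2 ∂μ) := by
  rw [eLpNorm_two_sq, ofReal_integral_eq_lintegral_ofReal hf.integrable_sq
    (ae_of_all _ fun x => sq_nonneg _)]
  refine lintegral_congr fun x => ?_
  rw [← ofReal_norm, ← ENNReal.ofReal_pow (norm_nonneg _), Real.norm_eq_abs, sq_abs]

/-- The surviving increment is the one over (a, b] ∩ (s, t]. The alternative a' = b' covers an empty
intersection: when a lies beyond t, a coefficient known at time a is not known at a', but it
multiplies zero. -/
theorem exists_increment_eq {Ω E : Type*} [AddCommGroup E] (B : ℝ → Ω → E) {a b s t : ℝ}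
    (hab : a ≤ b) (hst : s ≤ t) : ∃ a' b', s ≤ a' ∧ a' ≤ b' ∧ b' ≤ t ∧ (a ≤ a' ∨ a' = b') ∧
      ∀ ω, (B (min b t) ω - B (min a t) ω) - (B (min b s) ω - B (min a s) ω) =
        B b' ω - B a' ω := by
  rcases le_total b s with hbs | hbs
  · refine ⟨s, s, le_rfl, le_rfl, hst, Or.inr rfl, fun ω => ?_⟩
    rw [min_eq_left hbs, min_eq_left (hab.trans hbs), min_eq_left (hbs.trans hst),
      min_eq_left ((hab.trans hbs).trans hst)]
    simp
  rcases le_total a s with has | has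
  · refine ⟨s, min b t, le_rfl, le_min hbs hst, min_le_right _ _, Or.inl has, fun ω => ?_⟩
    rw [min_eq_left has, min_eq_left (has.trans hst), min_eq_right hbs]
    simp
  rcases le_total a t with hat | hat
  · refine ⟨a, min b t, has, le_min hab hat, min_le_right _ _, Or.inl le_rfl, fun ω => ?_⟩
    rw [min_eq_right has, min_eq_left hat, min_eq_right hbs]
    simp
  · refine ⟨t, t, hst, le_rfl, le_rfl, Or.inr rfl, fun ω => ?_⟩
    rw [min_eq_right has, min_eq_right hat, min_eq_right hbs, min_eq_right (hat.trans hab)]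
    simp

variable {Ω : Type*} [mΩ : MeasurableSpace Ω] {d : ℕ} {P : Measure Ω} {T : ℝ}
  {B : ℝ → Ω → EuclideanSpace ℝ (Fin d)}

theorem SimpleIntegrand.measurable_coeff (hB : IsBrownianMotionOn P T B)
    (H : SimpleIntegrand P T B) (i : ℕ) : Measurable (H.coeff i) :=
  (H.coeff_measurable i).mono (brownianFiltration_le hB (H.time_mem i).2) le_rfl

theorem SimpleIntegrand.memLp_integral [IsProbabilityMeasure P] (hB : IsBrownianMotionOn P T B)
    (H : SimpleIntegrand P T B) {t : ℝ} (ht : t ∈ Icc 0 T) : MemLp (H.integral t) 2 P := by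
  obtain ⟨C, hC⟩ := H.coeff_bounded
  refine memLp_finsetSum _ fun i _ => ?_
  rcases le_total (H.time i) t with h | h
  · rw [min_eq_left h]
    exact (hB.integral_inner_increment_sq (H.time_mem i).1
      (le_min (H.time_mono (Nat.le_succ i)) h) ((min_le_right _ _).trans ht.2)
      (H.coeff_measurable i) (hC i)).1
  · rw [min_eq_right h, min_eq_right (h.trans (H.time_mono (Nat.le_succ i)))]
    simp

/-- Martingale property of elementary integrals: after clipping to (s, t], each summand pairs an
increment with `U` times a coefficient, both known when that increment starts. -/
theorem SimpleIntegrand.integral_mul_sub_eq_zero [IsProbabilityMeasure P]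
    (hB : IsBrownianMotionOn P T B) (H : SimpleIntegrand P T B) {s t : ℝ} (hs : 0 ≤ s)
    (hst : s ≤ t) (ht : t ≤ T) {U : Ω → ℝ} (hU : Measurable[brownianFiltration P B s] U)
    (hUi : Integrable U P) :
    ∫ ω, U ω * (H.integral t ω - H.integral s ω) ∂P = 0 := by
  obtain ⟨C, hC⟩ := H.coeff_bounded
  have key : ∀ i, Integrable (fun ω => U ω * inner ℝ (H.coeff i ω)
      ((B (min (H.time (i + 1)) t) ω - B (min (H.time i) t) ω)
        - (B (min (H.time (i + 1)) s) ω - B (min (H.time i) s) ω))) P ∧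
      ∫ ω, U ω * inner ℝ (H.coeff i ω)
      ((B (min (H.time (i + 1)) t) ω - B (min (H.time i) t) ω)
        - (B (min (H.time (i + 1)) s) ω - B (min (H.time i) s) ω)) ∂P = 0 := by
    intro i
    obtain ⟨a, b, hsa, hab, hbt, h, he⟩ := exists_increment_eq B
      (H.time_mono (Nat.le_succ i)) hst
    simp only [he]
    rcases h with h | h
    · have hm : Measurable[brownianFiltration P B a] fun ω => U ω • H.coeff i ω :=
        (hU.mono (brownianFiltration_mono hsa) le_rfl).smul
          ((H.coeff_measurable i).mono (brownianFiltration_mono h) le_rfl)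
      have hi : Integrable (fun ω => U ω • H.coeff i ω) P :=
        (hUi.norm.const_mul C).mono' (hUi.aestronglyMeasurable.smul
          (H.measurable_coeff hB i).aestronglyMeasurable) (ae_of_all _ fun ω => by
            rw [norm_smul, mul_comm]
            exact mul_le_mul_of_nonneg_right (hC i ω) (norm_nonneg _))
      simpa only [real_inner_smul_left] using
        hB.integrable_inner_increment (hs.trans hsa) hab (hbt.trans ht) hm hi
    · subst h
      simp
  have he : ∀ ω, U ω * (H.integral t ω - H.integral s ω) = ∑ i ∈ Finset.range H.n,
      U ω * inner ℝ (H.coeff i ω) ((B (min (H.time (i + 1)) t) ω - B (min (H.time i) t) ω)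
        - (B (min (H.time (i + 1)) s) ω - B (min (H.time i) s) ω)) := by
    intro ω
    simp only [SimpleIntegrand.integral, inner_sub_right (𝕜 := ℝ) _ (_ - _) (_ - _), mul_sub,
      Finset.mul_sum, Finset.sum_sub_distrib]
  simp_rw [he]
  rw [integral_finsetSum _ fun i _ => (key i).1]
  exact Finset.sum_eq_zero fun i _ => (key i).2

theorem SimpleIntegrand.integral_sq [IsProbabilityMeasure P]
    (hB : IsBrownianMotionOn P T B) (H : SimpleIntegrand P T B) :
    ∫ ω, H.integral T ω ^ 2 ∂P =
      ∑ i ∈ Finset.range H.n, (H.time (i + 1) - H.time i) * ∫ ω, ‖H.coeff i ω‖ ^ 2 ∂P := by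
  obtain ⟨C, hC⟩ := H.coeff_bounded
  have hterm := fun i => hB.integral_inner_increment_sq (H.time_mem i).1
    (H.time_mono (Nat.le_succ i)) (H.time_mem (i + 1)).2 (H.coeff_measurable i) (hC i)
  have he : ∀ ω, H.integral T ω = ∑ i ∈ Finset.range H.n,
      inner ℝ (H.coeff i ω) (B (H.time (i + 1)) ω - B (H.time i) ω) := by
    intro ω
    simp only [SimpleIntegrand.integral, min_eq_left (H.time_mem _).2]
  simp_rw [he]
  rw [integral_sq_sum_of_orthogonal _ _ fun i _ => (hterm i).1]
  · exact Finset.sum_congr rfl fun i _ => (hterm i).2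
  -- For i < j, the whole i-th summand is known at the start of the j-th increment, so it can be
  -- absorbed into the coefficient and the cross term has mean zero.
  intro i j hij _
  have hij' : H.time (i + 1) ≤ H.time j := H.time_mono hij
  have hU : Measurable[brownianFiltration P B (H.time j)] fun ω =>
      inner ℝ (H.coeff i ω) (B (H.time (i + 1)) ω - B (H.time i) ω) :=
    Measurable.inner ((H.coeff_measurable i).mono
      (brownianFiltration_mono (H.time_mono hij.le)) le_rfl)
      ((measurable_brownianFiltration (H.time_mem _).1 hij').sub
        (measurable_brownianFiltration (H.time_mem _).1 (H.time_mono hij.le)))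
  have hUi := (hterm i).1.integrable (by simp)
  have hm : Measurable[brownianFiltration P B (H.time j)] fun ω =>
      inner ℝ (H.coeff i ω) (B (H.time (i + 1)) ω - B (H.time i) ω) • H.coeff j ω :=
    hU.smul (H.coeff_measurable j)
  have hi : Integrable (fun ω =>
      inner ℝ (H.coeff i ω) (B (H.time (i + 1)) ω - B (H.time i) ω) • H.coeff j ω) P :=
    (hUi.norm.const_mul C).mono' (hUi.aestronglyMeasurable.smul
      (H.measurable_coeff hB j).aestronglyMeasurable) (ae_of_all _ fun ω => by
        rw [norm_smul, mul_comm]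
        exact mul_le_mul_of_nonneg_right (hC j ω) (norm_nonneg _))
  simpa only [real_inner_smul_left] using (hB.integrable_inner_increment (H.time_mem j).1
    (H.time_mono (Nat.le_succ j)) (H.time_mem (j + 1)).2 hm hi).2

/-- The intervals are disjoint because the times are monotone, so at most one summand is nonzero at
`s` and squaring produces no cross terms. -/
theorem SimpleIntegrand.enorm_eval_sq (H : SimpleIntegrand P T B) (s : ℝ) (ω : Ω) :
    ‖H.eval s ω‖ₑ ^ 2 = ∑ i ∈ Finset.range H.n,
      (Ioc (H.time i) (H.time (i + 1))).indicator 1 s * ‖H.coeff i ω‖ₑ ^ 2 := by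
  unfold SimpleIntegrand.eval
  by_cases h : ∃ i ∈ Finset.range H.n, s ∈ Ioc (H.time i) (H.time (i + 1))
  · obtain ⟨i, hi, hs⟩ := h
    have hne : ∀ j, j ≠ i → s ∉ Ioc (H.time j) (H.time (j + 1)) := by
      intro j hji hj
      rcases lt_or_gt_of_ne hji with h | h
      · exact absurd (hj.2.trans (H.time_mono h)) (not_le.2 hs.1)
      · exact absurd (hs.2.trans (H.time_mono h)) (not_le.2 hj.1)
    rw [Finset.sum_eq_single i (fun j _ hj => indicator_of_notMem (hne j hj) _)
      (fun h => absurd hi h), Finset.sum_eq_single i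
      (fun j _ hj => by rw [indicator_of_notMem (hne j hj), zero_mul]) (fun h => absurd hi h),
      indicator_of_mem hs, indicator_of_mem hs]
    simp
  · push Not at h
    rw [Finset.sum_eq_zero fun i hi => indicator_of_notMem (h i hi) _,
      Finset.sum_eq_zero fun i hi => by rw [indicator_of_notMem (h i hi), zero_mul]]
    simp

theorem SimpleIntegrand.measurable_eval (hB : IsBrownianMotionOn P T B)
    (H : SimpleIntegrand P T B) : Measurable fun p : ℝ × Ω => H.eval p.1 p.2 := by
  unfold SimpleIntegrand.eval
  refine Finset.measurable_sum _ fun i _ => ?_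
  exact Measurable.indicator (s := {p : ℝ × Ω | p.1 ∈ Ioc (H.time i) (H.time (i + 1))})
    ((H.measurable_coeff hB i).comp measurable_snd) (measurable_fst measurableSet_Ioc)

theorem SimpleIntegrand.eLpNorm_eval [IsProbabilityMeasure P]
    (hB : IsBrownianMotionOn P T B) (hT : 0 ≤ T) (H : SimpleIntegrand P T B) :
    eLpNorm (fun p : ℝ × Ω => H.eval p.1 p.2) 2 (timeProd P T) =
      eLpNorm (H.integral T) 2 P := by
  obtain ⟨C, hC⟩ := H.coeff_bounded
  have hc : ∀ i, MemLp (H.coeff i) 2 P := fun i =>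
    MemLp.of_bound (H.measurable_coeff hB i).aestronglyMeasurable C (ae_of_all _ (hC i))
  rw [← (ENNReal.pow_right_strictMono two_ne_zero).injective.eq_iff]
  rw [eLpNorm_two_sq_eq_ofReal_integral (H.memLp_integral hB (right_mem_Icc.2 hT)),
    H.integral_sq hB, eLpNorm_two_sq]
  simp_rw [H.enorm_eval_sq]
  rw [lintegral_finsetSum, ENNReal.ofReal_sum_of_nonneg]
  · refine Finset.sum_congr rfl fun i _ => ?_
    rw [timeProd, lintegral_prod_mul (by measurability)
      ((H.measurable_coeff hB i).enorm.pow_const 2).aemeasurable,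
      ENNReal.ofReal_mul (sub_nonneg.2 (H.time_mono (Nat.le_succ i))),
      lintegral_indicator_one measurableSet_Ioc, Measure.restrict_apply measurableSet_Ioc,
      inter_eq_left.2 (Ioc_subset_Icc_self.trans
        (Icc_subset_Icc (H.time_mem i).1 (H.time_mem (i + 1)).2)), Real.volume_Ioc,
      ofReal_integral_eq_lintegral_ofReal (hc i).norm.integrable_sq
        (ae_of_all _ fun x => sq_nonneg _)]
    congr 1
    refine lintegral_congr fun x => ?_
    rw [← ofReal_norm, ← ENNReal.ofReal_pow (norm_nonneg _)]
  · exact fun i _ => mul_nonneg (sub_nonneg.2 (H.time_mono (Nat.le_succ i)))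
      (integral_nonneg fun ω => sq_nonneg _)
  · intro i _
    exact ((measurable_one.indicator measurableSet_Ioc).comp measurable_fst).mul
      (((H.measurable_coeff hB i).enorm.pow_const 2).comp measurable_snd)

theorem IsAdaptedOn.measurable (hB : IsBrownianMotionOn P T B) {E : Type*} [MeasurableSpace E]
    {X : ℝ → Ω → E} (hX : IsAdaptedOn P T B X) {t : ℝ} (ht : t ∈ Icc 0 T) : Measurable (X t) :=
  (hX t ht).mono (brownianFiltration_le hB ht.2) le_rfl

variable {Z : ℝ → Ω → EuclideanSpace ℝ (Fin d)} {I : ℝ → Ω → ℝ}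

theorem IsItoIntegral.memLp [IsProbabilityMeasure P] (hB : IsBrownianMotionOn P T B)
    (h : IsItoIntegral P T B Z I) {t : ℝ} (ht : t ∈ Icc 0 T) : MemLp (I t) 2 P := by
  obtain ⟨H, _, hH⟩ := h.approx
  obtain ⟨n, hn⟩ := ((hH t ht).eventually (gt_mem_nhds zero_lt_one)).exists
  have h1 : MemLp (fun ω => (H n).integral t ω - I t ω) 2 P :=
    ⟨((H n).memLp_integral hB ht).1.sub (h.adapted.measurable hB ht).aestronglyMeasurable,
      hn.trans ENNReal.one_lt_top⟩
  exact (((H n).memLp_integral hB ht).sub h1).ae_eq (ae_of_all _ fun ω => by simp)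

/-- The property passes from elementary integrals to their L² limits: by Cauchy–Schwarz,
multiplication by a square integrable `U` turns L² convergence into L¹ convergence. -/
theorem IsItoIntegral.integral_mul_sub_eq_zero [IsProbabilityMeasure P]
    (hB : IsBrownianMotionOn P T B) (h : IsItoIntegral P T B Z I) {s t : ℝ} (hs : 0 ≤ s)
    (hst : s ≤ t) (ht : t ≤ T) {U : Ω → ℝ} (hU : Measurable[brownianFiltration P B s] U)
    (hU2 : MemLp U 2 P) :
    ∫ ω, U ω * (I t ω - I s ω) ∂P = 0 := by
  obtain ⟨H, _, hH⟩ := h.approx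
  have hs' : s ∈ Icc 0 T := ⟨hs, hst.trans ht⟩
  have ht' : t ∈ Icc 0 T := ⟨hs.trans hst, ht⟩
  have hX := fun n => ((H n).memLp_integral hB ht').sub ((H n).memLp_integral hB hs')
  have hI := (h.memLp hB ht').sub (h.memLp hB hs')
  refine tendsto_nhds_unique (tendsto_integral_of_L1' (l := atTop)
    (F := fun n ω => U ω * ((H n).integral t ω - (H n).integral s ω))
    (fun ω => U ω * (I t ω - I s ω)) (hU2.1.mul hI.1)
    (Eventually.of_forall fun n => hU2.integrable_mul (hX n)) ?_) ?_
  · have hlim : Tendsto (fun n => eLpNorm U 2 P *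
        (eLpNorm (fun ω => (H n).integral t ω - I t ω) 2 P +
          eLpNorm (fun ω => (H n).integral s ω - I s ω) 2 P)) atTop (𝓝 0) := by
      have := ENNReal.Tendsto.const_mul (a := eLpNorm U 2 P) ((hH t ht').add (hH s hs'))
        (Or.inr hU2.2.ne)
      simpa using this
    refine tendsto_of_tendsto_of_tendsto_of_le_of_le tendsto_const_nhds hlim
      (fun _ => zero_le) fun n => ?_
    have h1 := ((H n).memLp_integral hB ht').sub (h.memLp hB ht')
    have h2 := ((H n).memLp_integral hB hs').sub (h.memLp hB hs')
    have he : ((fun ω => U ω * ((H n).integral t ω - (H n).integral s ω)) -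
        fun ω => U ω * (I t ω - I s ω)) =
        U • (((H n).integral t - I t) - ((H n).integral s - I s)) := by
      ext ω
      simp
      ring
    rw [he]
    refine (eLpNorm_smul_le_mul_eLpNorm (p := 2) (q := 2) (r := 1) (h1.sub h2).1 hU2.1).trans ?_
    gcongr
    exact eLpNorm_sub_le h1.1 h2.1 (by norm_num)
  · simp_rw [(H _).integral_mul_sub_eq_zero hB hs hst ht hU (hU2.integrable (by simp))]
    exact tendsto_const_nhds

theorem IsItoIntegral.ae_eq_zero_at_zero (hT : 0 ≤ T)
    (hB : IsBrownianMotionOn P T B) (h : IsItoIntegral P T B Z I) : I 0 =ᵐ[P] 0 := by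
  obtain ⟨H, _, hH⟩ := h.approx
  have h0 : ∀ n ω, (H n).integral 0 ω = 0 := fun n ω => by
    simp [SimpleIntegrand.integral, min_eq_right ((H n).time_mem _).1]
  have h2 : eLpNorm (-I 0) 2 P = 0 := tendsto_nhds_unique tendsto_const_nhds
    (by simpa only [h0, zero_sub] using! hH 0 (left_mem_Icc.2 hT))
  rw [eLpNorm_neg] at h2
  exact (eLpNorm_eq_zero_iff (h.adapted.measurable hB (left_mem_Icc.2 hT)).aestronglyMeasurable
    (by norm_num)).1 h2

/-- If the terminal integral vanishes, the elementary terminal integrals tend to 0 in L². By the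
isometry so do their integrands, which also tend to `Z`. -/
theorem IsItoIntegral.integrand_eq_zero [IsProbabilityMeasure P] (hT : 0 ≤ T)
    (hB : IsBrownianMotionOn P T B) (hZ : MemM2 P T B Z) (h : IsItoIntegral P T B Z I)
    (h0 : I T =ᵐ[P] 0) : ∀ᵐ p ∂(timeProd P T), Z p.1 p.2 = 0 := by
  obtain ⟨H, hHZ, hH⟩ := h.approx
  have h1 : Tendsto (fun n => eLpNorm (fun p : ℝ × Ω => (H n).eval p.1 p.2) 2 (timeProd P T))
      atTop (𝓝 0) := by
    simp_rw [SimpleIntegrand.eLpNorm_eval hB hT]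
    refine (hH T (right_mem_Icc.2 hT)).congr fun n => eLpNorm_congr_ae ?_
    filter_upwards [h0] with ω hω
    simp [hω]
  have h2 : eLpNorm (fun p : ℝ × Ω => Z p.1 p.2) 2 (timeProd P T) ≤ 0 := by
    refine ge_of_tendsto' (by simpa using h1.add hHZ) fun n => ?_
    have hm := ((H n).measurable_eval hB).aestronglyMeasurable (μ := timeProd P T)
    refine le_trans (le_of_eq ?_) (eLpNorm_sub_le hm (hm.sub hZ.memLp.1) (by norm_num))
    congr 1
    ext p : 1
    simp
  exact (eLpNorm_eq_zero_iff hZ.memLp.1 (by norm_num)).1 (le_antisymm h2 (zero_le))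

end ItoIntegral

/-! ### Backward Gronwall, path regularity and uniform grids. -/

section Comparison

/-- With u(t) = ∫ v over [t, T], the hypothesis says that e^{ct} u(t) is nondecreasing. It vanishes
at T, so u ≤ 0, and the hypothesis returns v ≤ 0. -/
theorem nonpos_of_le_mul_integral {v : ℝ → ℝ} {c T : ℝ} (hc : 0 ≤ c)
    (hv : ContinuousOn v (Icc 0 T)) (h : ∀ a ∈ Icc 0 T, v a ≤ c * ∫ r in a..T, v r)
    {a : ℝ} (ha : a ∈ Icc 0 T) : v a ≤ 0 := by
  have hT : 0 ≤ T := ha.1.trans ha.2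
  -- A continuous extension to the whole line makes `u` differentiable everywhere, including at the
  -- endpoints.
  set w : ℝ → ℝ := IccExtend hT ((Icc 0 T).domRestrict v) with hw
  have hwc : Continuous w := (continuousOn_iff_continuous_domRestrict.1 hv).Icc_extend'
  have hwv : ∀ r ∈ Icc 0 T, w r = v r := fun r hr => by
    rw [hw, IccExtend_of_mem _ _ hr, domRestrict_apply]
  set u : ℝ → ℝ := fun t => ∫ r in t..T, w r with hu
  have huv : ∀ r ∈ Icc 0 T, ∫ x in r..T, v x = u r := fun r hr =>
    intervalIntegral.integral_congr fun x hx => by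
      rw [uIcc_of_le hr.2] at hx
      exact (hwv x ⟨hr.1.trans hx.1, hx.2⟩).symm
  have hud : ∀ t, HasDerivAt u (-w t) t := fun t =>
    intervalIntegral.integral_hasDerivAt_left (hwc.intervalIntegrable _ _)
      (hwc.stronglyMeasurableAtFilter _ _) hwc.continuousAt
  have hfd : ∀ t, HasDerivAt (fun t => Real.exp (c * t) * u t)
      (Real.exp (c * t) * c * u t + Real.exp (c * t) * (-w t)) t := fun t => by
    have h1 : HasDerivAt (fun t => Real.exp (c * t)) (Real.exp (c * t) * c) t := by
      simpa using ((hasDerivAt_id t).const_mul c).exp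
    exact h1.mul (hud t)
  have hmono : MonotoneOn (fun t => Real.exp (c * t) * u t) (Icc 0 T) := by
    refine monotoneOn_of_deriv_nonneg (convex_Icc 0 T)
      (fun t _ => (hfd t).continuousAt.continuousWithinAt)
      (fun t _ => (hfd t).differentiableAt.differentiableWithinAt) fun t ht => ?_
    rw [(hfd t).deriv]
    have ht' := interior_subset ht
    have h1 := h t ht'
    rw [huv t ht', ← hwv t ht'] at h1
    have := mul_nonneg (Real.exp_pos (c * t)).le (sub_nonneg.2 h1)
    linarith
  have h1 := hmono ha (right_mem_Icc.2 hT) ha.2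
  have h2 : u T = 0 := by simp [hu]
  simp only [h2, mul_zero] at h1
  have h3 : u a ≤ 0 := by
    by_contra hpos
    exact absurd h1 (not_le.2 (mul_pos (Real.exp_pos _) (not_le.1 hpos)))
  have h4 := h a ha
  rw [huv a ha] at h4
  exact h4.trans (mul_nonpos_of_nonneg_of_nonpos hc h3)

variable {Ω : Type*} [mΩ : MeasurableSpace Ω] {d : ℕ} {P : Measure Ω} {T : ℝ}

theorem ae_forall_le_of_continuousOn (hT : 0 ≤ T) {X X' : ℝ → Ω → ℝ}
    (hX : ∀ᵐ ω ∂P, ContinuousOn (fun t => X t ω) (Icc 0 T))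
    (hX' : ∀ᵐ ω ∂P, ContinuousOn (fun t => X' t ω) (Icc 0 T))
    (h : ∀ t ∈ Icc 0 T, ∀ᵐ ω ∂P, X t ω ≤ X' t ω) :
    ∀ᵐ ω ∂P, ∀ t ∈ Icc 0 T, X t ω ≤ X' t ω := by
  have : Nonempty (Icc 0 T) := ⟨⟨0, left_mem_Icc.2 hT⟩⟩
  have hq : ∀ᵐ ω ∂P, ∀ n, X (TopologicalSpace.denseSeq (Icc 0 T) n) ω
      ≤ X' (TopologicalSpace.denseSeq (Icc 0 T) n) ω :=
    ae_all_iff.2 fun n => h _ (Subtype.coe_prop _)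
  filter_upwards [hX, hX', hq] with ω h1 h2 h3 t ht
  exact DenseRange.induction_on (p := fun t : Icc 0 T => X t ω ≤ X' t ω)
    (TopologicalSpace.denseRange_denseSeq (Icc 0 T)) ⟨t, ht⟩
    (isClosed_le (continuousOn_iff_continuous_domRestrict.1 h1)
      (continuousOn_iff_continuous_domRestrict.1 h2)) h3

/-- The supremum over a dense sequence of times is measurable, which is not clear for the full
supremum; by path continuity it still bounds the whole path almost surely. -/
theorem MemS2.exists_bound {B : ℝ → Ω → EuclideanSpace ℝ (Fin d)}
    (hB : IsBrownianMotionOn P T B) (hT : 0 ≤ T) {Y : ℝ → Ω → ℝ} (hY : MemS2 P T B Y) :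
    ∃ g : Ω → ℝ, MemLp g 2 P ∧ ∀ᵐ ω ∂P, ∀ t ∈ Icc 0 T, |Y t ω| ≤ g ω := by
  have : Nonempty (Icc 0 T) := ⟨⟨0, left_mem_Icc.2 hT⟩⟩
  set q := TopologicalSpace.denseSeq (Icc 0 T)
  set G : Ω → ENNReal := fun ω => ⨆ n, ‖Y (q n) ω‖ₑ ^ 2 with hG
  have hGm : Measurable G := .iSup fun n =>
    (hY.adapted.measurable hB (Subtype.coe_prop (q n))).enorm.pow_const 2
  have hGi : ∫⁻ ω, G ω ∂P < ⊤ := (lintegral_mono fun ω => iSup_le fun n =>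
    le_iSup₂ (f := fun t (_ : t ∈ Icc 0 T) => ‖Y t ω‖ₑ ^ 2) (q n : ℝ)
      (Subtype.coe_prop (q n))).trans_lt hY.sup_sq
  refine ⟨fun ω => √(G ω).toReal, ⟨hGm.ennreal_toReal.sqrt.aestronglyMeasurable, ?_⟩, ?_⟩
  · have h2 : eLpNorm (fun ω => √(G ω).toReal) 2 P ^ 2 < ⊤ := by
      rw [eLpNorm_two_sq]
      refine (lintegral_mono fun ω => ?_).trans_lt hGi
      rw [Real.enorm_eq_ofReal (Real.sqrt_nonneg _), ← ENNReal.ofReal_pow (Real.sqrt_nonneg _),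
        Real.sq_sqrt ENNReal.toReal_nonneg]
      exact ENNReal.ofReal_toReal_le
    by_contra hne
    rw [not_lt, top_le_iff] at hne
    simp [hne] at h2
  · filter_upwards [hY.continuous_paths, ae_lt_top hGm hGi.ne] with ω hc hfin t ht
    have hle : ‖Y t ω‖ₑ ^ 2 ≤ G ω :=
      DenseRange.induction_on (p := fun t : Icc 0 T => ‖Y t ω‖ₑ ^ 2 ≤ G ω)
        (TopologicalSpace.denseRange_denseSeq (Icc 0 T)) ⟨t, ht⟩
        (isClosed_le ((ENNReal.continuous_pow 2).comp
          (continuous_enorm.comp (continuousOn_iff_continuous_domRestrict.1 hc))) continuous_const)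
        fun n => le_iSup (fun n => ‖Y (q n) ω‖ₑ ^ 2) n
    refine Real.abs_le_sqrt ?_
    have h3 := ENNReal.toReal_mono hfin.ne hle
    simpa using h3

/-- Setting the process to zero on a measurable null set and freezing time outside [0, T] makes
every path continuous. Joint measurability follows from this, so Fubini applies to the expected
drift. -/
theorem exists_continuous_version (hT : 0 ≤ T) {X : ℝ → Ω → ℝ} {g : Ω → ℝ}
    (hm : ∀ t ∈ Icc 0 T, Measurable (X t))
    (hc : ∀ᵐ ω ∂P, ContinuousOn (fun t => X t ω) (Icc 0 T))
    (hg : ∀ᵐ ω ∂P, ∀ t ∈ Icc 0 T, |X t ω| ≤ g ω) :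
    ∃ W : ℝ → Ω → ℝ, (∀ ω, Continuous fun t => W t ω) ∧ (∀ t, Measurable (W t)) ∧
      (∀ t ω, |W t ω| ≤ |g ω|) ∧ ∀ᵐ ω ∂P, ∀ t ∈ Icc 0 T, W t ω = X t ω := by
  obtain ⟨N, hN, hNm, hN0⟩ := exists_measurable_superset_of_null (ae_iff.1 (hc.and hg))
  have hgood : ∀ ω, ω ∉ N → ContinuousOn (fun t => X t ω) (Icc 0 T) ∧
      ∀ t ∈ Icc 0 T, |X t ω| ≤ g ω := fun ω hω => by
    by_contra h
    exact hω (hN h)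
  refine ⟨fun t => Nᶜ.indicator (X (projIcc 0 T hT t)), fun ω => ?_, fun t => ?_, fun t ω => ?_, ?_⟩
  · by_cases hω : ω ∈ N
    · simp [hω, continuous_const]
    · simp only [indicator_of_mem (show ω ∈ Nᶜ from hω)]
      exact (continuousOn_iff_continuous_domRestrict.1 (hgood ω hω).1).comp continuous_projIcc
  · exact (hm _ (Subtype.coe_prop _)).indicator hNm.compl
  · by_cases hω : ω ∈ N
    · simp [hω]
    · simp only [indicator_of_mem (show ω ∈ Nᶜ from hω)]
      exact ((hgood ω hω).2 _ (Subtype.coe_prop _)).trans (le_abs_self _)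
  · filter_upwards [measure_eq_zero_iff_ae_notMem.1 hN0] with ω hω t ht
    rw [indicator_of_mem (show ω ∈ Nᶜ from hω), projIcc_of_mem hT ht]

/-- The `i`-th point of the uniform partition of `[a, b]` into `n + 1` intervals. -/
noncomputable def uniformGrid (a b : ℝ) (n i : ℕ) : ℝ := a + i * ((b - a) / (n + 1))

theorem uniformGrid_zero (a b : ℝ) (n : ℕ) : uniformGrid a b n 0 = a := by simp [uniformGrid]

theorem uniformGrid_last (a b : ℝ) (n : ℕ) : uniformGrid a b n (n + 1) = b := by
  have : (n : ℝ) + 1 ≠ 0 := by positivity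
  rw [uniformGrid]
  push_cast
  field_simp
  ring

theorem uniformGrid_succ (a b : ℝ) (n i : ℕ) :
    uniformGrid a b n (i + 1) = uniformGrid a b n i + (b - a) / (n + 1) := by
  rw [uniformGrid, uniformGrid]
  push_cast
  ring

theorem uniformGrid_monotone {a b : ℝ} (hab : a ≤ b) (n : ℕ) : Monotone (uniformGrid a b n) :=
  monotone_nat_of_le_succ fun i => by
    rw [uniformGrid_succ]
    have := div_nonneg (sub_nonneg.2 hab) (by positivity : (0 : ℝ) ≤ n + 1)
    linarith

theorem uniformGrid_mem {a b : ℝ} (hab : a ≤ b) {n i : ℕ} (hi : i ≤ n + 1) :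
    uniformGrid a b n i ∈ Icc a b :=
  ⟨(uniformGrid_zero a b n).symm.le.trans (uniformGrid_monotone hab n (Nat.zero_le i)),
    (uniformGrid_monotone hab n hi).trans (uniformGrid_last a b n).le⟩

theorem tendsto_mesh (a b : ℝ) : Tendsto (fun n : ℕ => (b - a) / ((n : ℝ) + 1)) atTop (𝓝 0) := by
  simpa [div_eq_mul_inv] using (tendsto_one_div_add_atTop_nhds_zero_nat (𝕜 := ℝ)).const_mul (b - a)

end Comparison

/-! ### The comparison principle. -/

section ComparisonPrinciple

variable {Ω : Type*} [mΩ : MeasurableSpace Ω] {d : ℕ} {P : Measure Ω} {T : ℝ}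

/-- The sum is exactly zero as soon as the mesh is below δ. -/
theorem tendsto_sum_indicator_increment {D K : ℝ → ℝ} {a T δ : ℝ} (ha : a ∈ Icc 0 T) (hδ : 0 < δ)
    (h : ∀ s ∈ Icc 0 T, ∀ t ∈ Icc 0 T, s ≤ t → t ≤ s + δ → 0 < D s → K t = K s) :
    Tendsto (fun n => ∑ i ∈ Finset.range (n + 1), if 0 < D (uniformGrid a T n i) then
      K (uniformGrid a T n (i + 1)) - K (uniformGrid a T n i) else 0) atTop (𝓝 0) := by
  refine tendsto_const_nhds.congr' ?_
  filter_upwards [(tendsto_mesh a T).eventually (gt_mem_nhds hδ)] with n hn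
  refine (Finset.sum_eq_zero fun i hi => ?_).symm
  have hi' : i < n + 1 := Finset.mem_range.1 hi
  have hsub : Icc a T ⊆ Icc 0 T := Icc_subset_Icc_left ha.1
  split_ifs with hD
  · rw [h _ (hsub (uniformGrid_mem ha.2 hi'.le)) _ (hsub (uniformGrid_mem ha.2 hi'))
      (uniformGrid_monotone ha.2 n (Nat.le_succ i)) (by rw [uniformGrid_succ]; linarith) hD,
      sub_self]
  · rfl

theorem abs_sum_indicator_increment_le {D K : ℝ → ℝ} {a T k : ℝ} (ha : a ∈ Icc 0 T)
    (hK : MonotoneOn K (Icc 0 T)) (hk : ∀ t ∈ Icc 0 T, |K t| ≤ k) (n : ℕ) :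
    |∑ i ∈ Finset.range (n + 1), if 0 < D (uniformGrid a T n i) then
      K (uniformGrid a T n (i + 1)) - K (uniformGrid a T n i) else 0| ≤ 2 * k := by
  have hsub : Icc a T ⊆ Icc 0 T := Icc_subset_Icc_left ha.1
  have hinc : ∀ i ∈ Finset.range (n + 1),
      0 ≤ K (uniformGrid a T n (i + 1)) - K (uniformGrid a T n i) := fun i hi =>
    sub_nonneg.2 (hK (hsub (uniformGrid_mem ha.2 (Finset.mem_range.1 hi).le))
      (hsub (uniformGrid_mem ha.2 (Finset.mem_range.1 hi)))
      (uniformGrid_monotone ha.2 n (Nat.le_succ i)))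
  rw [abs_of_nonneg (Finset.sum_nonneg fun i hi => by
    split_ifs
    exacts [hinc i hi, le_rfl])]
  calc _ ≤ ∑ i ∈ Finset.range (n + 1),
        (K (uniformGrid a T n (i + 1)) - K (uniformGrid a T n i)) :=
        Finset.sum_le_sum fun i hi => by
          split_ifs
          exacts [le_rfl, hinc i hi]
    _ = K T - K a := by
        rw [Finset.sum_range_sub (fun i => K (uniformGrid a T n i)), uniformGrid_last,
          uniformGrid_zero]
    _ ≤ 2 * k := by
        have h1 := abs_le.1 (hk T (right_mem_Icc.2 (ha.1.trans ha.2)))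
        have h2 := abs_le.1 (hk a ha)
        linarith [h1.2, h2.1]

/-- A comparison principle: a process whose positive part can only grow backwards in time through
a linear drift, a martingale, and an increasing process that is flat where the process is
positive, is nonpositive as soon as its terminal value is. -/
theorem ae_nonpos_of_le_increments [IsProbabilityMeasure P]
    {B : ℝ → Ω → EuclideanSpace ℝ (Fin d)} (hB : IsBrownianMotionOn P T B) (hT : 0 ≤ T)
    {D K M : ℝ → Ω → ℝ} {g k : Ω → ℝ} {c : ℝ} (hc : 0 ≤ c)
    (hD : IsAdaptedOn P T B D) (hDc : ∀ᵐ ω ∂P, ContinuousOn (fun t => D t ω) (Icc 0 T))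
    (hg : Integrable g P) (hDg : ∀ᵐ ω ∂P, ∀ t ∈ Icc 0 T, |D t ω| ≤ g ω)
    (hK : ∀ t ∈ Icc 0 T, Measurable (K t))
    (hKmono : ∀ᵐ ω ∂P, MonotoneOn (fun t => K t ω) (Icc 0 T))
    (hk : Integrable k P) (hKk : ∀ᵐ ω ∂P, ∀ t ∈ Icc 0 T, |K t ω| ≤ k ω)
    (hM : ∀ t ∈ Icc 0 T, Integrable (M t) P)
    (hMart : ∀ s t, 0 ≤ s → s ≤ t → t ≤ T → ∀ A, MeasurableSet[brownianFiltration P B s] A →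
      ∫ ω in A, (M t ω - M s ω) ∂P = 0)
    (hle : ∀ᵐ ω ∂P, ∀ s ∈ Icc 0 T, ∀ t ∈ Icc 0 T, s ≤ t →
      D s ω ≤ D t ω + (∫ r in s..t, c * max (D r ω) 0) + (K t ω - K s ω) + (M t ω - M s ω))
    (hflat : ∀ᵐ ω ∂P, ∃ δ > 0, ∀ s ∈ Icc 0 T, ∀ t ∈ Icc 0 T, s ≤ t → t ≤ s + δ →
      0 < D s ω → K t ω = K s ω)
    (hend : ∀ᵐ ω ∂P, D T ω ≤ 0) :
    ∀ᵐ ω ∂P, ∀ t ∈ Icc 0 T, D t ω ≤ 0 := by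
  have hDm : ∀ t ∈ Icc 0 T, Measurable (D t) := fun t ht => hD.measurable hB ht
  have hDi : ∀ t ∈ Icc 0 T, Integrable (D t) P := fun t ht =>
    hg.mono' (hDm t ht).aestronglyMeasurable (hDg.mono fun ω h => h t ht)
  have hKi : ∀ t ∈ Icc 0 T, Integrable (K t) P := fun t ht =>
    hk.mono' (hK t ht).aestronglyMeasurable (hKk.mono fun ω h => h t ht)
  obtain ⟨W, hWc, hWm, hWg, hWD⟩ := exists_continuous_version (P := P) (g := g) hT
    (X := fun t ω => max (D t ω) 0) (fun t ht => (hDm t ht).max measurable_const)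
    (hDc.mono fun ω h => h.sup continuousOn_const)
    (hDg.mono fun ω h t ht => by
      refine le_trans ?_ (h t ht)
      rw [abs_of_nonneg (le_max_right _ _)]
      exact max_le (le_abs_self _) (abs_nonneg _))
  have hWi : ∀ t, Integrable (W t) P := fun t =>
    hg.norm.mono' (hWm t).aestronglyMeasurable (ae_of_all _ (hWg t))
  set v : ℝ → ℝ := fun t => ∫ ω, W t ω ∂P with hv
  have hvc : Continuous v := continuous_of_dominated (fun t => (hWm t).aestronglyMeasurable)
    (fun t => ae_of_all _ (hWg t)) hg.abs (ae_of_all _ hWc)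
  have hWprod : ∀ s t : ℝ, Integrable (Function.uncurry fun r ω => c * W r ω)
      ((volume.restrict (Ioc s t)).prod P) := fun s t => by
    have h1 : Measurable (Function.uncurry W) :=
      measurable_uncurry_of_continuous_of_measurable hWc hWm
    exact ((hg.norm.comp_snd (volume.restrict (Ioc s t))).mono' h1.aestronglyMeasurable
      (ae_of_all _ fun p => hWg p.1 p.2)).const_mul c
  have hJi : ∀ s t : ℝ, s ≤ t → Integrable (fun ω => ∫ r in s..t, c * W r ω) P := fun s t hst => by
    simp_rw [intervalIntegral.integral_of_le hst]
    exact (hWprod s t).integral_prod_right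
  have hJ : ∀ s t : ℝ, s ≤ t → ∫ ω, (∫ r in s..t, c * W r ω) ∂P = c * ∫ r in s..t, v r := by
    intro s t hst
    simp_rw [intervalIntegral.integral_of_le hst]
    rw [← integral_integral_swap (hWprod s t), ← integral_const_mul]
    simp_rw [integral_const_mul]
    rfl
  -- Integrate the increment inequality over A = {D_s > 0}. The left side becomes v(s), the
  -- martingale term vanishes because A is known at time s, and the nonnegative terms D_t⁺ and c∫D⁺
  -- may be integrated over all of Ω.
  have hstep : ∀ s ∈ Icc 0 T, ∀ t ∈ Icc 0 T, s ≤ t → v s ≤ v t + c * (∫ r in s..t, v r) +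
      ∫ ω, (if 0 < D s ω then K t ω - K s ω else 0) ∂P := by
    intro s hs t ht hst
    set A : Set Ω := {ω | 0 < D s ω} with hA
    have hAF : MeasurableSet[brownianFiltration P B s] A := hD s hs measurableSet_Ioi
    have hAm : MeasurableSet A := brownianFiltration_le hB hs.2 _ hAF
    have hKs : ∫ ω, (if 0 < D s ω then K t ω - K s ω else 0) ∂P =
        ∫ ω in A, (K t ω - K s ω) ∂P := by
      rw [← integral_indicator hAm]
      rfl
    have hKts : IntegrableOn (fun ω => K t ω - K s ω) A P :=
      ((hKi t ht).sub (hKi s hs)).integrableOn (s := A)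
    have hMts : IntegrableOn (fun ω => M t ω - M s ω) A P :=
      ((hM t ht).sub (hM s hs)).integrableOn (s := A)
    have h1 : v s = ∫ ω in A, D s ω ∂P := by
      rw [← integral_indicator hAm]
      refine integral_congr_ae ?_
      filter_upwards [hWD] with ω hω
      rw [hω s hs]
      by_cases h : 0 < D s ω
      · rw [indicator_of_mem (show ω ∈ A from h), max_eq_left h.le]
      · rw [indicator_of_notMem (show ω ∉ A from h), max_eq_right (not_lt.1 h)]
    have hWJ : Integrable (fun ω => W t ω + ∫ r in s..t, c * W r ω) P := (hWi t).add (hJi s t hst)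
    have h2 : ∫ ω in A, D s ω ∂P ≤ ∫ ω in A, (((W t ω + ∫ r in s..t, c * W r ω) +
        (K t ω - K s ω)) + (M t ω - M s ω)) ∂P := by
      refine integral_mono_ae (hDi s hs).integrableOn
        ((hWJ.integrableOn.add hKts).add hMts)
        (ae_restrict_of_ae ?_)
      filter_upwards [hWD, hle] with ω hω hl
      have h3 := hl s hs t ht hst
      have h4 : ∫ r in s..t, c * max (D r ω) 0 = ∫ r in s..t, c * W r ω :=
        intervalIntegral.integral_congr fun r hr => by
          rw [uIcc_of_le hst] at hr
          simp only [hω r ⟨hs.1.trans hr.1, hr.2.trans ht.2⟩]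
      have h5 : D t ω ≤ W t ω := (le_max_left _ _).trans (hω t ht).ge
      rw [h4] at h3
      linarith
    have hWJK : IntegrableOn (fun ω => (W t ω + ∫ r in s..t, c * W r ω) + (K t ω - K s ω)) A P :=
      hWJ.integrableOn.add hKts
    have h6 : ∫ ω in A, (((W t ω + ∫ r in s..t, c * W r ω) +
        (K t ω - K s ω)) + (M t ω - M s ω)) ∂P = ∫ ω in A, (W t ω + ∫ r in s..t, c * W r ω) ∂P +
        ∫ ω in A, (K t ω - K s ω) ∂P + ∫ ω in A, (M t ω - M s ω) ∂P := by
      rw [← integral_add hWJ.integrableOn hKts, ← integral_add hWJK hMts]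
    have h7 : ∫ ω in A, (W t ω + ∫ r in s..t, c * W r ω) ∂P ≤
        ∫ ω, (W t ω + ∫ r in s..t, c * W r ω) ∂P := by
      refine setIntegral_le_integral hWJ ?_
      filter_upwards [hWD] with ω hω
      refine add_nonneg ((le_max_right _ _).trans (hω t ht).ge)
        (intervalIntegral.integral_nonneg hst fun r hr => mul_nonneg hc ?_)
      exact (le_max_right _ _).trans (hω r ⟨hs.1.trans hr.1, hr.2.trans ht.2⟩).ge
    rw [integral_add (hWi t) (hJi s t hst), hJ s t hst] at h7
    rw [h6, hMart s t hs.1 hst ht.2 A hAF, add_zero] at h2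
    rw [h1, hKs]
    linarith
  have hsum : ∀ a ∈ Icc 0 T, ∀ n : ℕ, v a ≤ c * (∫ r in a..T, v r) +
      ∫ ω, ∑ i ∈ Finset.range (n + 1), (if 0 < D (uniformGrid a T n i) ω then
        K (uniformGrid a T n (i + 1)) ω - K (uniformGrid a T n i) ω else 0) ∂P := by
    intro a ha n
    have hmem : ∀ i ≤ n + 1, uniformGrid a T n i ∈ Icc 0 T := fun i hi =>
      Icc_subset_Icc_left ha.1 (uniformGrid_mem ha.2 hi)
    have hinc : ∀ i ∈ Finset.range (n + 1), Integrable (fun ω =>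
        if 0 < D (uniformGrid a T n i) ω then
          K (uniformGrid a T n (i + 1)) ω - K (uniformGrid a T n i) ω else 0) P := fun i hi => by
      have hi' := Finset.mem_range.1 hi
      exact ((hKi _ (hmem _ hi')).sub (hKi _ (hmem _ hi'.le))).indicator
        (hDm _ (hmem _ hi'.le) measurableSet_Ioi)
    rw [integral_finsetSum _ hinc]
    have hind : ∀ j ≤ n + 1, v a ≤ v (uniformGrid a T n j) +
        c * (∫ r in a..uniformGrid a T n j, v r) + ∑ i ∈ Finset.range j,
        ∫ ω, (if 0 < D (uniformGrid a T n i) ω then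
          K (uniformGrid a T n (i + 1)) ω - K (uniformGrid a T n i) ω else 0) ∂P := by
      intro j
      induction j with
      | zero => simp [uniformGrid_zero]
      | succ j ih =>
        intro hj
        have h1 := ih (by omega)
        have h2 := hstep _ (hmem j (by omega)) _ (hmem (j + 1) hj)
          (uniformGrid_monotone ha.2 n (Nat.le_succ j))
        rw [Finset.sum_range_succ, ← intervalIntegral.integral_add_adjacent_intervals
          (hvc.intervalIntegrable a (uniformGrid a T n j)) (hvc.intervalIntegrable _ _), mul_add]
        linarith
    have h1 := hind (n + 1) le_rfl
    rw [uniformGrid_last] at h1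
    have h2 : v T = 0 := by
      refine integral_eq_zero_of_ae ?_
      filter_upwards [hWD, hend] with ω h3 h4
      rw [h3 T (right_mem_Icc.2 hT), max_eq_right h4]
      rfl
    linarith
  -- The inequality holds for every grid and its left side does not depend on n. Letting n grow
  -- removes the `K` sum: it tends to 0 pathwise by flatness and is dominated by 2k.
  have hgron : ∀ a ∈ Icc 0 T, v a ≤ c * ∫ r in a..T, v r := by
    intro a ha
    have hmem : ∀ n, ∀ i ≤ n + 1, uniformGrid a T n i ∈ Icc 0 T := fun n i hi =>
      Icc_subset_Icc_left ha.1 (uniformGrid_mem ha.2 hi)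
    have hlim := tendsto_integral_of_dominated_convergence (μ := P)
      (F := fun n ω => ∑ i ∈ Finset.range (n + 1), (if 0 < D (uniformGrid a T n i) ω then
        K (uniformGrid a T n (i + 1)) ω - K (uniformGrid a T n i) ω else 0))
      (f := fun _ => (0 : ℝ)) (fun ω => 2 * k ω)
      (fun n => (Finset.measurable_sum _ fun i hi => Measurable.ite
        (hDm _ (hmem n i (Finset.mem_range.1 hi).le) measurableSet_Ioi)
        ((hK _ (hmem n _ (Finset.mem_range.1 hi))).sub
          (hK _ (hmem n i (Finset.mem_range.1 hi).le))) measurable_const).aestronglyMeasurable)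
      (hk.const_mul 2)
      (fun n => by
        filter_upwards [hKmono, hKk] with ω h1 h2
        exact abs_sum_indicator_increment_le (D := fun t => D t ω) (K := fun t => K t ω) ha h1 h2 n)
      (by
        filter_upwards [hflat] with ω ⟨δ, hδ, h1⟩
        exact tendsto_sum_indicator_increment (D := fun t => D t ω) (K := fun t => K t ω) ha hδ h1)
    have := ge_of_tendsto' (hlim.const_add (c * ∫ r in a..T, v r)) (hsum a ha)
    simpa using this
  refine ae_forall_le_of_continuousOn hT hDc (ae_of_all _ fun ω => continuousOn_const)
    fun t ht => ?_
  have hv0 : ∫ ω, W t ω ∂P ≤ 0 := nonpos_of_le_mul_integral hc hvc.continuousOn hgron ht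
  have hnn : 0 ≤ᵐ[P] W t := by
    filter_upwards [hWD] with ω hω
    exact (le_max_right _ _).trans (hω t ht).ge
  have h0 := (integral_eq_zero_iff_of_nonneg_ae hnn (hWi t)).1
    (le_antisymm hv0 (integral_nonneg_of_ae hnn))
  filter_upwards [h0, hWD] with ω h1 h2
  exact (le_max_left _ _).trans ((h2 t ht).symm.trans h1).le

end ComparisonPrinciple

/-! ### Stochastic integrals of finite variation vanish. -/

section FiniteVariation

theorem sum_abs_increment_le {f V : ℝ → ℝ} {b T : ℝ} (hb : b ∈ Icc 0 T)
    (h : ∀ s ∈ Icc 0 T, ∀ t ∈ Icc 0 T, s ≤ t → |f t - f s| ≤ V t - V s) (n : ℕ) :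
    ∑ i ∈ Finset.range (n + 1), |f (uniformGrid 0 b n (i + 1)) - f (uniformGrid 0 b n i)| ≤
      V b - V 0 := by
  have hsub : Icc 0 b ⊆ Icc 0 T := Icc_subset_Icc_right hb.2
  refine (Finset.sum_le_sum fun i hi => h _
    (hsub (uniformGrid_mem hb.1 (Finset.mem_range.1 hi).le)) _
    (hsub (uniformGrid_mem hb.1 (Finset.mem_range.1 hi)))
    (uniformGrid_monotone hb.1 n (Nat.le_succ i))).trans ?_
  rw [Finset.sum_range_sub (fun i => V (uniformGrid 0 b n i)), uniformGrid_last, uniformGrid_zero]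

/-- The sum of squares is at most the largest increment times the total variation; uniform
continuity makes the first factor small. -/
theorem tendsto_sum_sq_increment {f V : ℝ → ℝ} {b T : ℝ} (hb : b ∈ Icc 0 T)
    (hf : ContinuousOn f (Icc 0 T))
    (h : ∀ s ∈ Icc 0 T, ∀ t ∈ Icc 0 T, s ≤ t → |f t - f s| ≤ V t - V s) :
    Tendsto (fun n => ∑ i ∈ Finset.range (n + 1),
      (f (uniformGrid 0 b n (i + 1)) - f (uniformGrid 0 b n i)) ^ 2) atTop (𝓝 0) := by
  have hsub : Icc 0 b ⊆ Icc 0 T := Icc_subset_Icc_right hb.2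
  have hV : 0 ≤ V b - V 0 :=
    (abs_nonneg _).trans (h 0 ⟨le_rfl, hb.1.trans hb.2⟩ b hb hb.1)
  rw [Metric.tendsto_atTop']
  intro ε hε
  -- The added 1 keeps the denominator positive when the variation bound is zero, and makes the
  -- final inequality strict.
  obtain ⟨δ, hδ, hδf⟩ := Metric.uniformContinuousOn_iff.1
    (isCompact_Icc.uniformContinuousOn_of_continuous hf) (ε / (V b - V 0 + 1)) (by positivity)
  obtain ⟨N, hN⟩ := eventually_atTop.1 ((tendsto_mesh 0 b).eventually (gt_mem_nhds hδ))
  refine ⟨N, fun n hn => ?_⟩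
  rw [Real.dist_eq, sub_zero, abs_of_nonneg (Finset.sum_nonneg fun i _ => sq_nonneg _)]
  calc ∑ i ∈ Finset.range (n + 1), (f (uniformGrid 0 b n (i + 1)) - f (uniformGrid 0 b n i)) ^ 2
      ≤ ∑ i ∈ Finset.range (n + 1), ε / (V b - V 0 + 1) *
          |f (uniformGrid 0 b n (i + 1)) - f (uniformGrid 0 b n i)| := by
        refine Finset.sum_le_sum fun i hi => ?_
        rw [← sq_abs, pow_two]
        refine mul_le_mul_of_nonneg_right ?_ (abs_nonneg _)
        refine (hδf _ (hsub (uniformGrid_mem hb.1 (Finset.mem_range.1 hi))) _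
          (hsub (uniformGrid_mem hb.1 (Finset.mem_range.1 hi).le)) ?_).le
        rw [uniformGrid_succ, Real.dist_eq, add_sub_cancel_left, abs_of_nonneg]
        · exact hN n hn.le
        · exact div_nonneg (sub_nonneg.2 hb.1) (by positivity)
    _ ≤ ε / (V b - V 0 + 1) * (V b - V 0) := by
        rw [← Finset.mul_sum]
        exact mul_le_mul_of_nonneg_left (sum_abs_increment_le hb h n) (by positivity)
    _ < ε := by
        rw [div_mul_eq_mul_div, div_lt_iff₀ (by positivity)]
        nlinarith

variable {Ω : Type*} [mΩ : MeasurableSpace Ω] {d : ℕ} {P : Measure Ω} {T : ℝ}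
  {B : ℝ → Ω → EuclideanSpace ℝ (Fin d)} {Z : ℝ → Ω → EuclideanSpace ℝ (Fin d)}
  {I : ℝ → Ω → ℝ}

/-- A stochastic integral with paths of square integrable variation vanishes. -/
theorem IsItoIntegral.ae_eq_zero_of_finite_variation [IsProbabilityMeasure P] (hT : 0 ≤ T)
    (hB : IsBrownianMotionOn P T B) (hI : IsItoIntegral P T B Z I) {V : ℝ → Ω → ℝ} {g : Ω → ℝ}
    (hg : MemLp g 2 P) (hVg : ∀ᵐ ω ∂P, ∀ t ∈ Icc 0 T, |V t ω| ≤ g ω)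
    (hV : ∀ᵐ ω ∂P, ∀ s ∈ Icc 0 T, ∀ t ∈ Icc 0 T, s ≤ t → |I t ω - I s ω| ≤ V t ω - V s ω) :
    ∀ᵐ ω ∂P, ∀ t ∈ Icc 0 T, I t ω = 0 := by
  have hI0 := hI.ae_eq_zero_at_zero hT hB
  have key : ∀ b ∈ Icc 0 T, I b =ᵐ[P] 0 := by
    intro b hb
    have hmem : ∀ n, ∀ i ≤ n + 1, uniformGrid 0 b n i ∈ Icc 0 T := fun n i hi =>
      Icc_subset_Icc_right hb.2 (uniformGrid_mem hb.1 hi)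
    have hf : ∀ n, ∀ i < n + 1, MemLp
        (fun ω => I (uniformGrid 0 b n (i + 1)) ω - I (uniformGrid 0 b n i) ω) 2 P := fun n i hi =>
      (hI.memLp hB (hmem n _ hi)).sub (hI.memLp hB (hmem n i hi.le))
    -- Martingale increments are orthogonal, so the second moment over [0, b] equals the expected
    -- discrete quadratic variation for every n, and the limit below forces it to be zero.
    have horth : ∀ n : ℕ, ∫ ω, (I b ω - I 0 ω) ^ 2 ∂P = ∫ ω, ∑ i ∈ Finset.range (n + 1),
        (I (uniformGrid 0 b n (i + 1)) ω - I (uniformGrid 0 b n i) ω) ^ 2 ∂P := by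
      intro n
      have h1 := integral_sq_sum_of_orthogonal
        (fun i ω => I (uniformGrid 0 b n (i + 1)) ω - I (uniformGrid 0 b n i) ω) (n + 1)
        (hf n) fun i j hij hj => ?_
      · rw [integral_finsetSum _ fun i hi => (hf n i (Finset.mem_range.1 hi)).integrable_sq, ← h1]
        refine integral_congr_ae (ae_of_all _ fun ω => ?_)
        simp only
        rw [Finset.sum_range_sub (fun i => I (uniformGrid 0 b n i) ω), uniformGrid_last,
          uniformGrid_zero]
      · have hmono := uniformGrid_monotone hb.1 n
        refine hI.integral_mul_sub_eq_zero hB (hmem n j hj.le).1 (hmono (Nat.le_succ j))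
          (hmem n (j + 1) hj).2 (Measurable.sub ?_ ?_) (hf n i (by omega))
        · exact (hI.adapted _ (hmem n _ (by omega))).mono (brownianFiltration_mono (hmono hij))
            le_rfl
        · exact (hI.adapted _ (hmem n _ (by omega))).mono
            (brownianFiltration_mono (hmono hij.le)) le_rfl
    have hlim := tendsto_integral_of_dominated_convergence (μ := P)
      (F := fun n ω => ∑ i ∈ Finset.range (n + 1),
        (I (uniformGrid 0 b n (i + 1)) ω - I (uniformGrid 0 b n i) ω) ^ 2)
      (f := fun _ => (0 : ℝ)) (fun ω => 4 * g ω ^ 2)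
      (fun n => (integrable_finsetSum _ fun i hi =>
        (hf n i (Finset.mem_range.1 hi)).integrable_sq).1)
      (hg.integrable_sq.const_mul 4)
      (fun n => by
        filter_upwards [hVg, hV] with ω h1 h2
        rw [Real.norm_eq_abs, abs_of_nonneg (Finset.sum_nonneg fun i _ => sq_nonneg _)]
        have h3 := sum_abs_increment_le (f := fun t => I t ω) (V := fun t => V t ω) hb h2 n
        have h4 : V b ω - V 0 ω ≤ 2 * g ω := by
          have h5 := abs_le.1 (h1 b hb)
          have h6 := abs_le.1 (h1 0 (left_mem_Icc.2 hT))
          linarith [h5.2, h6.1]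
        have h7 : 0 ≤ ∑ i ∈ Finset.range (n + 1),
            |I (uniformGrid 0 b n (i + 1)) ω - I (uniformGrid 0 b n i) ω| :=
          Finset.sum_nonneg fun i _ => abs_nonneg _
        calc _ = ∑ i ∈ Finset.range (n + 1),
              |I (uniformGrid 0 b n (i + 1)) ω - I (uniformGrid 0 b n i) ω| ^ 2 := by
              simp only [sq_abs]
          _ ≤ (∑ i ∈ Finset.range (n + 1),
              |I (uniformGrid 0 b n (i + 1)) ω - I (uniformGrid 0 b n i) ω|) ^ 2 :=
              Finset.sum_sq_le_sq_sum_of_nonneg fun i _ => abs_nonneg _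
          _ ≤ (2 * g ω) ^ 2 := pow_le_pow_left₀ h7 (h3.trans h4) 2
          _ = 4 * g ω ^ 2 := by ring)
      (by
        filter_upwards [hI.continuous_paths, hV] with ω h1 h2
        exact tendsto_sum_sq_increment (f := fun t => I t ω) (V := fun t => V t ω) hb h1 h2)
    simp_rw [← horth, integral_zero] at hlim
    have hz := tendsto_nhds_unique hlim tendsto_const_nhds
    have hsq := ((hI.memLp hB hb).sub (hI.memLp hB (left_mem_Icc.2 hT))).integrable_sq
    have h0 := (integral_eq_zero_iff_of_nonneg (fun ω => sq_nonneg _) hsq).1 hz.symm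
    filter_upwards [h0, hI0] with ω h1 h2
    have h3 : I b ω - I 0 ω = 0 := by simpa using! h1
    rw [Pi.zero_apply] at h2 ⊢
    linarith
  have hz : ∀ᵐ ω ∂P, ContinuousOn (fun _ : ℝ => (0 : ℝ)) (Icc 0 T) :=
    ae_of_all _ fun _ => continuousOn_const
  filter_upwards [ae_forall_le_of_continuousOn (X' := fun _ _ => 0) hT hI.continuous_paths hz
    fun t ht => (key t ht).mono fun ω h => h.le,
    ae_forall_le_of_continuousOn (X := fun _ _ => 0) hT hz hI.continuous_paths
    fun t ht => (key t ht).mono fun ω h => h.ge] with ω h1 h2 t ht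
  exact le_antisymm (h1 t ht) (h2 t ht)

end FiniteVariation

/-! ### The Skorokhod condition as local flatness. -/

section Skorokhod

/-- A path whose Stieltjes measure does not charge `{f > 0}` is locally constant, at a uniform
scale, around the points of a closed set on which `f` is positive. -/
theorem StieltjesIntegralEqZero.exists_flat {T : ℝ} {f k D : ℝ → ℝ}
    (h : StieltjesIntegralEqZero T f k) (hf : ContinuousOn f (Icc 0 T))
    (hf0 : ∀ t ∈ Icc 0 T, 0 ≤ f t) (hD : ContinuousOn D (Icc 0 T))
    (hDf : ∀ t ∈ Icc 0 T, 0 ≤ D t → 0 < f t) :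
    ∃ δ > 0, ∀ s ∈ Icc 0 T, ∀ t ∈ Icc 0 T, s ≤ t → t ≤ s + δ → 0 < D s → k t = k s := by
  obtain ⟨κ, hκ, hi, h0⟩ := h
  have hC : IsClosed (Icc 0 T ∩ f ⁻¹' Iic 0) := hf.preimage_isClosed_of_isClosed isClosed_Icc
    isClosed_Iic
  have hF : IsClosed (Icc 0 T ∩ D ⁻¹' Ici 0) := hD.preimage_isClosed_of_isClosed isClosed_Icc
    isClosed_Ici
  have hdisj : Disjoint (Icc 0 T ∩ f ⁻¹' Iic 0) (Icc 0 T ∩ D ⁻¹' Ici 0) :=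
    Set.disjoint_left.2 fun t ht ht' => absurd (hDf t ht.1 ht'.2) (not_lt.2 ht.2)
  -- The zero set of f is compact and {D ≥ 0} is closed and disjoint from it, so they are a positive
  -- distance apart. Thus f stays positive just after any point where D > 0; halving δ gives the
  -- strict inequality defining the thickening.
  obtain ⟨δ, hδ, hth⟩ := hdisj.exists_thickenings (isCompact_Icc.of_isClosed_subset hC
    inter_subset_left) hF
  have hae := (setIntegral_eq_zero_iff_of_nonneg_ae
    ((ae_restrict_iff' measurableSet_Ioc).2 (ae_of_all _ fun t ht =>
      hf0 t (Ioc_subset_Icc_self ht))) hi).1 h0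
  refine ⟨δ / 2, half_pos hδ, fun s hs t ht hst hts hDs => ?_⟩
  have hpos : ∀ r ∈ Ioc s t, 0 < f r := by
    intro r hr
    have hr' : r ∈ Icc 0 T := ⟨hs.1.trans hr.1.le, hr.2.trans ht.2⟩
    by_contra hneg
    refine Set.disjoint_left.1 hth ?_ (Metric.self_subset_thickening hδ _ ⟨hs, hDs.le⟩)
    refine Metric.mem_thickening_iff.2 ⟨r, ⟨hr', not_lt.1 hneg⟩, ?_⟩
    rw [dist_comm, Real.dist_eq, abs_of_nonneg (sub_nonneg.2 hr.1.le)]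
    linarith [hr.2]
  have hnull : κ.measure (Ioc s t) = 0 := by
    rw [EventuallyEq, ae_restrict_iff' measurableSet_Ioc] at hae
    refine measure_mono_null (fun r hr => ?_) (ae_iff.1 hae)
    intro himp
    exact (hpos r hr).ne' (himp ⟨hs.1.trans_lt hr.1, hr.2.trans ht.2⟩)
  rw [StieltjesFunction.measure_Ioc, ENNReal.ofReal_eq_zero] at hnull
  rw [← hκ t ht, ← hκ s hs]
  exact le_antisymm (by linarith) (κ.mono hst)

end Skorokhod

/-! ### Deterministic processes as candidate solutions. -/

section DeterministicProcesses

variable {Ω : Type*} [mΩ : MeasurableSpace Ω] {d : ℕ} {P : Measure Ω} {T : ℝ}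
  {B : ℝ → Ω → EuclideanSpace ℝ (Fin d)}

theorem memS2_deterministic [IsProbabilityMeasure P] {f : ℝ → ℝ} (hf : Continuous f) :
    MemS2 P T B fun t _ => f t where
  adapted _ _ := measurable_const
  continuous_paths := ae_of_all _ fun _ => hf.continuousOn
  sup_sq := by
    obtain ⟨C, hC⟩ := (isCompact_Icc (a := 0) (b := T)).exists_bound_of_continuousOn hf.continuousOn
    have h : ⨆ t ∈ Icc 0 T, ‖f t‖ₑ ^ 2 ≤ ENNReal.ofReal C ^ 2 := iSup₂_le fun t ht => by
      rw [← ofReal_norm]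
      gcongr
      exact hC t ht
    simp only [lintegral_const, measure_univ, mul_one]
    exact h.trans_lt (ENNReal.pow_lt_top ENNReal.ofReal_lt_top)

theorem memA2_deterministic [IsProbabilityMeasure P] {f : ℝ → ℝ} (hf : Continuous f)
    (hm : Monotone f) (h0 : f 0 = 0) : MemA2 P T B fun t _ => f t where
  toMemS2 := memS2_deterministic hf
  monotone_paths := ae_of_all _ fun _ => hm.monotoneOn _
  start := ae_of_all _ fun _ => h0

theorem memM2_zero : MemM2 P T B fun _ _ => 0 where
  adapted _ _ := measurable_const
  memLp := MemLp.zero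

theorem isItoIntegral_zero (hT : 0 ≤ T) : IsItoIntegral P T B (fun _ _ => 0) fun _ _ => 0 where
  adapted _ _ := measurable_const
  continuous_paths := ae_of_all _ fun _ => continuousOn_const
  approx := by
    refine ⟨fun _ => ⟨0, fun _ => 0, fun _ _ => 0, monotone_const, fun _ => left_mem_Icc.2 hT,
      fun _ => measurable_const, 0, fun _ _ => by simp⟩, ?_, fun t _ => ?_⟩
    · simp [SimpleIntegrand.eval]
    · simp [SimpleIntegrand.integral]

theorem stieltjesIntegralEqZero_zero {k : ℝ → ℝ} (hk : Continuous k) (hm : Monotone k) :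
    StieltjesIntegralEqZero T (fun _ => 0) k :=
  ⟨⟨k, hm, fun _ => hk.continuousWithinAt⟩, fun _ _ => rfl, by simp, by simp⟩

theorem integral_mul_exp_sub {c : ℝ} (T s t : ℝ) :
    ∫ r in s..t, c * Real.exp (c * (T - r)) =
      Real.exp (c * (T - s)) - Real.exp (c * (T - t)) := by
  have h : ∀ r, HasDerivAt (fun r => -Real.exp (c * (T - r))) (c * Real.exp (c * (T - r))) r := by
    intro r
    have h1 := ((((hasDerivAt_id r).const_sub T).const_mul c).exp).neg
    refine h1.congr_deriv ?_
    simp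
    ring
  rw [intervalIntegral.integral_eq_sub_of_hasDerivAt (fun r _ => h r)
    ((by fun_prop : Continuous fun r => c * Real.exp (c * (T - r))).intervalIntegrable _ _)]
  ring

end DeterministicProcesses

/-! ### A single reflected linear equation. -/

section ReflectedEquations

variable {Ω : Type*} [mΩ : MeasurableSpace Ω] {d : ℕ} {P : Measure Ω} {T : ℝ}
  {B : ℝ → Ω → EuclideanSpace ℝ (Fin d)} {Z : ℝ → Ω → EuclideanSpace ℝ (Fin d)}
  {Y K K' I : ℝ → Ω → ℝ} {q τ : ℝ}

/-- The increments of a process with drift `q Y`, reflected by `τ K`, with martingale part `I`. -/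
def HasReflectedIncrements (P : Measure Ω) (T q τ : ℝ) (Y K I : ℝ → Ω → ℝ) : Prop :=
  ∀ᵐ ω ∂P, ∀ s ∈ Icc 0 T, ∀ t ∈ Icc 0 T, s ≤ t →
    Y s ω = Y t ω + (∫ r in s..t, q * Y r ω) + τ * (K t ω - K s ω) - (I t ω - I s ω)

theorem hasReflectedIncrements_of_backward {ξ : ℝ}
    (hi : ∀ᵐ ω ∂P, IntervalIntegrable (fun s => q * Y s ω) volume 0 T)
    (h : ∀ᵐ ω ∂P, ∀ t ∈ Icc 0 T, Y t ω = ξ + (∫ s in t..T, q * Y s ω) +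
      τ * (K T ω - K t ω) - (I T ω - I t ω)) : HasReflectedIncrements P T q τ Y K I := by
  filter_upwards [hi, h] with ω h1 h2 s hs t ht hst
  have hsub : ∀ a ∈ Icc 0 T, ∀ b ∈ Icc 0 T,
      IntervalIntegrable (fun s => q * Y s ω) volume a b := fun a ha b hb =>
    h1.mono_set (by
      rw [uIcc_of_le (ha.1.trans ha.2)]
      exact ordConnected_Icc.uIcc_subset ha hb)
  have h3 := intervalIntegral.integral_add_adjacent_intervals (hsub s hs t ht)
    (hsub t ht T (right_mem_Icc.2 (ht.1.trans ht.2)))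
  rw [h2 s hs, h2 t ht, ← h3]
  ring

/-- Comparison of `σ Y` with a deterministic function, from a bound on the drift. -/
theorem HasReflectedIncrements.ae_le [IsProbabilityMeasure P] (hT : 0 ≤ T)
    (hB : IsBrownianMotionOn P T B) (hI : IsItoIntegral P T B Z I)
    (h : HasReflectedIncrements P T q τ Y K I) (hY : MemS2 P T B Y) (hK' : MemA2 P T B K')
    {σ c : ℝ} (hc : 0 ≤ c) {l m : ℝ → ℝ} (hl : Continuous l) (hm : Continuous m)
    (hlm : ∀ s t, l s = l t + ∫ r in s..t, m r)
    (hdrift : ∀ᵐ ω ∂P, ∀ r ∈ Icc 0 T,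
      σ * (q * Y r ω) + m r ≤ c * max (σ * Y r ω + l r) 0)
    (hKK' : ∀ᵐ ω ∂P, ∀ s ∈ Icc 0 T, ∀ t ∈ Icc 0 T, s ≤ t →
      σ * τ * (K t ω - K s ω) ≤ K' t ω - K' s ω)
    (hflat : ∀ᵐ ω ∂P, ∃ δ > 0, ∀ s ∈ Icc 0 T, ∀ t ∈ Icc 0 T, s ≤ t → t ≤ s + δ →
      0 < σ * Y s ω + l s → K' t ω = K' s ω)
    (hend : ∀ᵐ ω ∂P, σ * Y T ω + l T ≤ 0) :
    ∀ᵐ ω ∂P, ∀ t ∈ Icc 0 T, σ * Y t ω + l t ≤ 0 := by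
  obtain ⟨g, hg, hYg⟩ := hY.exists_bound hB hT
  obtain ⟨k, hk, hKk⟩ := hK'.toMemS2.exists_bound hB hT
  obtain ⟨C, hC⟩ := (isCompact_Icc (a := 0) (b := T)).exists_bound_of_continuousOn hl.continuousOn
  -- Multiplying the equation by σ gives reflection στK, of which only the majorant K' enters. It
  -- will be zero when the reflection helps (στ = -1), and K itself when it hurts (στ = 1).
  refine ae_nonpos_of_le_increments hB hT (D := fun t ω => σ * Y t ω + l t) (K := K')
    (M := fun t ω => -σ * I t ω) (g := fun ω => |σ| * g ω + C) (k := k) hc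
    (fun t ht => ((hY.adapted t ht).const_mul σ).add_const (l t)) ?_
    (((hg.integrable (by simp)).const_mul _).add (integrable_const C)) ?_
    (fun t ht => hK'.adapted.measurable hB ht) hK'.monotone_paths (hk.integrable (by simp)) hKk
    (fun t ht => ((hI.memLp hB ht).integrable (by simp)).const_mul _) ?_ ?_ hflat hend
  · filter_upwards [hY.continuous_paths] with ω hω
    exact (hω.const_mul σ).add hl.continuousOn
  · filter_upwards [hYg] with ω hω t ht
    refine (abs_add_le _ _).trans (add_le_add ?_ (hC t ht))
    rw [abs_mul]
    exact mul_le_mul_of_nonneg_left (hω t ht) (abs_nonneg σ)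
  · intro s t hs hst ht A hA
    have hAm : MeasurableSet A := brownianFiltration_le hB (hst.trans ht) _ hA
    have h1 := hI.integral_mul_sub_eq_zero hB hs hst ht
      (U := A.indicator fun _ => -σ) (measurable_const.indicator hA)
      (MemLp.indicator hAm (memLp_const _))
    rw [← integral_indicator hAm, ← h1]
    refine integral_congr_ae (ae_of_all _ fun ω => ?_)
    by_cases hω : ω ∈ A
    · simp only [indicator_of_mem hω]
      ring
    · simp only [indicator_of_notMem hω, zero_mul]
  · filter_upwards [h, hdrift, hKK', hY.continuous_paths] with ω h1 h2 h3 h4 s hs t ht hst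
    have hsub : Icc s t ⊆ Icc 0 T := Icc_subset_Icc hs.1 ht.2
    have h4' : ContinuousOn (fun r => Y r ω) (uIcc s t) := by
      rw [uIcc_of_le hst]
      exact h4.mono hsub
    have hint1 : IntervalIntegrable (fun r => σ * (q * Y r ω)) volume s t :=
      ((h4'.const_mul q).const_mul σ).intervalIntegrable
    have hint2 : IntervalIntegrable (fun r => c * max (σ * Y r ω + l r) 0) volume s t :=
      ((((h4'.const_mul σ).add hl.continuousOn).sup continuousOn_const).const_mul c).intervalIntegrable
    have h5 := intervalIntegral.integral_mono_on hst
      (hint1.add (hm.intervalIntegrable s t)) hint2 fun r hr => h2 r (hsub hr)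
    rw [intervalIntegral.integral_add hint1 (hm.intervalIntegrable s t),
      intervalIntegral.integral_const_mul] at h5
    have h6 := congrArg (σ * ·) (h1 s hs t ht hst)
    have h7 := hlm s t
    have h8 := h3 s hs t ht hst
    linarith

/-- If the process `Y` is exponential, then its martingale part vanishes and its reflecting
process is determined. -/
theorem HasReflectedIncrements.eq_of_eq_exp [IsProbabilityMeasure P] (hT : 0 ≤ T)
    (hB : IsBrownianMotionOn P T B) (hI : IsItoIntegral P T B Z I) (hZ : MemM2 P T B Z)
    (h : HasReflectedIncrements P T q τ Y K I) (hK : MemA2 P T B K) (hτ : |τ| ≤ 1) {c : ℝ}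
    (hc : 0 < c) (hY : ∀ᵐ ω ∂P, ∀ t ∈ Icc 0 T, Y t ω = Real.exp (c * (T - t))) :
    (∀ᵐ p ∂(timeProd P T), Z p.1 p.2 = 0) ∧ ∀ᵐ ω ∂P, ∀ t ∈ Icc 0 T,
      τ * K t ω = (1 - q / c) * (Real.exp (c * T) - Real.exp (c * (T - t))) := by
  obtain ⟨k, hk, hKk⟩ := hK.toMemS2.exists_bound hB hT
  have hinc : ∀ᵐ ω ∂P, ∀ s ∈ Icc 0 T, ∀ t ∈ Icc 0 T, s ≤ t → I t ω - I s ω =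
      τ * (K t ω - K s ω) -
        (1 - q / c) * (Real.exp (c * (T - s)) - Real.exp (c * (T - t))) := by
    filter_upwards [h, hY] with ω h1 h2 s hs t ht hst
    have h3 : ∫ r in s..t, q * Y r ω =
        q / c * (Real.exp (c * (T - s)) - Real.exp (c * (T - t))) := by
      rw [← integral_mul_exp_sub, ← intervalIntegral.integral_const_mul]
      refine intervalIntegral.integral_congr fun r hr => ?_
      rw [uIcc_of_le hst] at hr
      simp only [h2 r ⟨hs.1.trans hr.1, hr.2.trans ht.2⟩]
      field_simp
    have h4 := h1 s hs t ht hst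
    rw [h3, h2 s hs, h2 t ht] at h4
    linarith
  have hI0 : ∀ᵐ ω ∂P, ∀ t ∈ Icc 0 T, I t ω = 0 := by
    -- The increments of I combine those of τK and of an exponential. Both K and -e^{c(T-t)}
    -- increase and |τ| ≤ 1, so V is their sum, the latter weighted by |1 - q/c|.
    refine hI.ae_eq_zero_of_finite_variation hT hB
      (V := fun t ω => K t ω - |1 - q / c| * Real.exp (c * (T - t)))
      (g := fun ω => k ω + |1 - q / c| * Real.exp (c * T)) (hk.add (memLp_const _)) ?_ ?_
    · filter_upwards [hKk] with ω hω t ht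
      refine (abs_sub _ _).trans (add_le_add (hω t ht) ?_)
      rw [abs_mul, abs_abs, Real.abs_exp]
      gcongr
      linarith [ht.1]
    · filter_upwards [hinc, hK.monotone_paths] with ω h1 h2 s hs t ht hst
      rw [h1 s hs t ht hst]
      have h3 : 0 ≤ K t ω - K s ω := sub_nonneg.2 (h2 hs ht hst)
      have h4 : 0 ≤ Real.exp (c * (T - s)) - Real.exp (c * (T - t)) := by
        refine sub_nonneg.2 (Real.exp_le_exp.2 ?_)
        gcongr
      refine (abs_sub _ _).trans ?_
      rw [abs_mul, abs_mul, abs_of_nonneg h3, abs_of_nonneg h4]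
      have h5 := mul_le_mul_of_nonneg_right hτ h3
      linarith
  refine ⟨hI.integrand_eq_zero hT hB hZ (hI0.mono fun ω h => h T (right_mem_Icc.2 hT)), ?_⟩
  filter_upwards [hinc, hI0, hK.start] with ω h1 h2 h3 t ht
  have h4 := h1 0 (left_mem_Icc.2 hT) t ht ht.1
  rw [h2 t ht, h2 0 (left_mem_Icc.2 hT), h3] at h4
  simp only [sub_zero] at h4
  linarith

end ReflectedEquations

/-! ### Exponential bounds and the two extremal solutions. -/

section LinearSystem

variable {Ω : Type*} [mΩ : MeasurableSpace Ω] {d : ℕ} {P : Measure Ω} {T : ℝ}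
  {B : ℝ → Ω → EuclideanSpace ℝ (Fin d)} {S : Sextuple Ω d}

theorem memA2_zero [IsProbabilityMeasure P] : MemA2 P T B fun _ _ => 0 :=
  memA2_deterministic continuous_const monotone_const rfl

theorem IsSolution.exists_increments₁ (h : IsSolution P T B (dataS2 Ω d) S) :
    ∃ I, IsItoIntegral P T B S.Z₁ I ∧ HasReflectedIncrements P T 1 1 S.Y₁ S.K₁ I := by
  obtain ⟨I, hI, he⟩ := h.eq₁
  exact ⟨I, hI, hasReflectedIncrements_of_backward (ξ := 1)
    (by simpa [dataS2] using h.drift₁) (by simpa [dataS2] using he)⟩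

theorem IsSolution.exists_increments₂ (h : IsSolution P T B (dataS2 Ω d) S) :
    ∃ I, IsItoIntegral P T B S.Z₂ I ∧ HasReflectedIncrements P T 2 (-1) S.Y₂ S.K₂ I := by
  obtain ⟨I, hI, he⟩ := h.eq₂
  refine ⟨I, hI, hasReflectedIncrements_of_backward (ξ := 1) h.drift₂ ?_⟩
  filter_upwards [he] with ω hω t ht
  rw [hω t ht]
  simp only [dataS2]
  ring

theorem IsSolution.terminal₁ (hT : 0 ≤ T) (h : IsSolution P T B (dataS2 Ω d) S) :
    ∀ᵐ ω ∂P, S.Y₁ T ω = 1 := by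
  obtain ⟨I, _, he⟩ := h.eq₁
  filter_upwards [he] with ω hω
  simpa [dataS2] using hω T (right_mem_Icc.2 hT)

theorem IsSolution.terminal₂ (hT : 0 ≤ T) (h : IsSolution P T B (dataS2 Ω d) S) :
    ∀ᵐ ω ∂P, S.Y₂ T ω = 1 := by
  obtain ⟨I, _, he⟩ := h.eq₂
  filter_upwards [he] with ω hω
  simpa [dataS2] using hω T (right_mem_Icc.2 hT)

theorem IsSolution.le_Y₁ (h : IsSolution P T B (dataS2 Ω d) S) :
    ∀ᵐ ω ∂P, ∀ t ∈ Icc 0 T, S.Y₂ t ω ≤ S.Y₁ t ω := by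
  simpa [dataS2] using h.obstacle₁

theorem IsSolution.skorokhod₁' (h : IsSolution P T B (dataS2 Ω d) S) :
    ∀ᵐ ω ∂P, StieltjesIntegralEqZero T (fun s => S.Y₁ s ω - S.Y₂ s ω) (fun s => S.K₁ s ω) := by
  simpa [dataS2] using h.skorokhod₁

theorem IsSolution.skorokhod₂' (h : IsSolution P T B (dataS2 Ω d) S) :
    ∀ᵐ ω ∂P, StieltjesIntegralEqZero T (fun s => S.Y₁ s ω - S.Y₂ s ω) (fun s => S.K₂ s ω) := by
  simpa [dataS2] using h.skorokhod₂

theorem one_le_exp_mul_sub {c t : ℝ} (hc : 0 ≤ c) (ht : t ∈ Icc 0 T) :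
    1 ≤ Real.exp (c * (T - t)) :=
  Real.one_le_exp (mul_nonneg hc (sub_nonneg.2 ht.2))

/-- The reflection only pushes `Y₁` up, so for D = e^{T-t} - Y₁ it is discarded (K' = 0), and the
drift of D is exactly D. -/
theorem IsSolution.exp_le_Y₁ [IsProbabilityMeasure P] (hT : 0 ≤ T) (hB : IsBrownianMotionOn P T B)
    (h : IsSolution P T B (dataS2 Ω d) S) :
    ∀ᵐ ω ∂P, ∀ t ∈ Icc 0 T, Real.exp (T - t) ≤ S.Y₁ t ω := by
  obtain ⟨I, hI, hinc⟩ := h.exists_increments₁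
  have key := hinc.ae_le hT hB hI h.memY₁ (memA2_zero (B := B)) (σ := -1) (c := 1)
    (l := fun t => Real.exp (1 * (T - t))) (m := fun t => 1 * Real.exp (1 * (T - t)))
    zero_le_one (by fun_prop) (by fun_prop)
    (fun s t => by rw [integral_mul_exp_sub]; ring)
    (ae_of_all _ fun ω r _ => by
      have := le_max_left (-1 * S.Y₁ r ω + Real.exp (1 * (T - r))) 0
      linarith)
    (h.memK₁.monotone_paths.mono fun ω hω s hs t ht hst => by
      have : S.K₁ s ω ≤ S.K₁ t ω := hω hs ht hst
      linarith)
    (ae_of_all _ fun ω => ⟨1, one_pos, fun _ _ _ _ _ _ _ => rfl⟩)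
    ((h.terminal₁ hT).mono fun ω hω => by simp [hω])
  filter_upwards [key] with ω hω t ht
  have := hω t ht
  rw [one_mul] at this
  linarith

theorem IsSolution.Y₂_le_exp [IsProbabilityMeasure P] (hT : 0 ≤ T) (hB : IsBrownianMotionOn P T B)
    (h : IsSolution P T B (dataS2 Ω d) S) :
    ∀ᵐ ω ∂P, ∀ t ∈ Icc 0 T, S.Y₂ t ω ≤ Real.exp (2 * (T - t)) := by
  obtain ⟨I, hI, hinc⟩ := h.exists_increments₂
  have key := hinc.ae_le hT hB hI h.memY₂ (memA2_zero (B := B)) (σ := 1) (c := 2)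
    (l := fun t => -Real.exp (2 * (T - t))) (m := fun t => -(2 * Real.exp (2 * (T - t))))
    zero_le_two (by fun_prop) (by fun_prop)
    (fun s t => by rw [intervalIntegral.integral_neg, integral_mul_exp_sub]; ring)
    (ae_of_all _ fun ω r _ => by
      have := le_max_left (1 * S.Y₂ r ω + -Real.exp (2 * (T - r))) 0
      linarith)
    (h.memK₂.monotone_paths.mono fun ω hω s hs t ht hst => by
      have : S.K₂ s ω ≤ S.K₂ t ω := hω hs ht hst
      linarith)
    (ae_of_all _ fun ω => ⟨1, one_pos, fun _ _ _ _ _ _ _ => rfl⟩)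
    ((h.terminal₂ hT).mono fun ω hω => by simp [hω])
  filter_upwards [key] with ω hω t ht
  have := hω t ht
  linarith

theorem ae_forall_nonpos_of_forall_sub_le {X : ℝ → Ω → ℝ}
    (h : ∀ ε, 0 < ε → ε ≤ 1 / 2 → ∀ᵐ ω ∂P, ∀ t ∈ Icc 0 T, X t ω - ε ≤ 0) :
    ∀ᵐ ω ∂P, ∀ t ∈ Icc 0 T, X t ω ≤ 0 := by
  have h' : ∀ᵐ ω ∂P, ∀ n : ℕ, ∀ t ∈ Icc 0 T, X t ω - 1 / ((n : ℝ) + 1) / 2 ≤ 0 := by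
    refine ae_all_iff.2 fun n => h _ (by positivity) ?_
    have : 1 / ((n : ℝ) + 1) ≤ 1 := (div_le_one (by positivity)).2 (by linarith [n.cast_nonneg (α := ℝ)])
    linarith
  filter_upwards [h'] with ω hω t ht
  have hlim : Tendsto (fun n : ℕ => X t ω - 1 / ((n : ℝ) + 1) / 2) atTop (𝓝 (X t ω)) := by
    simpa using ((tendsto_one_div_add_atTop_nhds_zero_nat (𝕜 := ℝ)).div_const 2).const_sub (X t ω)
  exact le_of_tendsto' hlim fun n => hω n t ht

/-- For D = e^{T-t} - ε - Y₂, D ≥ 0 forces Y₂ < e^{T-t} ≤ Y₁, so the obstacle is inactive and `K₂`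
is flat there. The shift ε makes the gap strict on the closed set {D ≥ 0}. The drift bound e^{T-t} -
2Y₂ ≤ 2D needs 2ε ≤ e^{T-t}, whence ε ≤ 1/2. -/
theorem IsSolution.exp_le_Y₂ [IsProbabilityMeasure P] (hT : 0 ≤ T) (hB : IsBrownianMotionOn P T B)
    (h : IsSolution P T B (dataS2 Ω d) S) :
    ∀ᵐ ω ∂P, ∀ t ∈ Icc 0 T, Real.exp (T - t) ≤ S.Y₂ t ω := by
  obtain ⟨I, hI, hinc⟩ := h.exists_increments₂
  have key := ae_forall_nonpos_of_forall_sub_le (P := P) (T := T)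
    (X := fun t ω => Real.exp (1 * (T - t)) - S.Y₂ t ω) fun ε hε hε2 => ?_
  · filter_upwards [key] with ω hω t ht
    have := hω t ht
    rw [one_mul] at this
    linarith
  have := hinc.ae_le hT hB hI h.memY₂ h.memK₂ (σ := -1) (c := 2)
    (l := fun t => Real.exp (1 * (T - t)) - ε) (m := fun t => 1 * Real.exp (1 * (T - t)))
    zero_le_two (by fun_prop) (by fun_prop)
    (fun s t => by rw [integral_mul_exp_sub]; ring)
    (ae_of_all _ fun ω r hr => by
      have h1 := le_max_left (-1 * S.Y₂ r ω + (Real.exp (1 * (T - r)) - ε)) 0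
      have h2 := one_le_exp_mul_sub (T := T) zero_le_one hr
      linarith)
    (ae_of_all _ fun ω s _ t _ _ => by linarith)
    (by
      filter_upwards [h.skorokhod₂', h.memY₁.continuous_paths, h.memY₂.continuous_paths,
        h.le_Y₁, h.exp_le_Y₁ hT hB] with ω h1 h2 h3 h4 h5
      refine h1.exists_flat (h2.sub h3) (fun t ht => sub_nonneg.2 (h4 t ht))
        (D := fun s => -1 * S.Y₂ s ω + (Real.exp (1 * (T - s)) - ε))
        ((h3.const_mul _).add (by fun_prop)) fun t ht hD => ?_
      have h6 := h5 t ht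
      rw [one_mul] at hD
      linarith)
    ((h.terminal₂ hT).mono fun ω hω => by
      rw [hω, sub_self, mul_zero, Real.exp_zero]
      linarith)
  filter_upwards [this] with ω hω t ht
  have := hω t ht
  linarith

/-- Mirror image: where Y₁ ≥ e^{2(T-t)} + ε, the bound Y₂ ≤ e^{2(T-t)} leaves a strict gap and `K₁`
is flat. The drift Y₁ - 2e^{2(T-t)} is at most D because ε ≤ e^{2(T-t)}. -/
theorem IsSolution.Y₁_le_exp [IsProbabilityMeasure P] (hT : 0 ≤ T) (hB : IsBrownianMotionOn P T B)
    (h : IsSolution P T B (dataS2 Ω d) S) :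
    ∀ᵐ ω ∂P, ∀ t ∈ Icc 0 T, S.Y₁ t ω ≤ Real.exp (2 * (T - t)) := by
  obtain ⟨I, hI, hinc⟩ := h.exists_increments₁
  have key := ae_forall_nonpos_of_forall_sub_le (P := P) (T := T)
    (X := fun t ω => S.Y₁ t ω - Real.exp (2 * (T - t))) fun ε hε hε2 => ?_
  · filter_upwards [key] with ω hω t ht
    linarith [hω t ht]
  have := hinc.ae_le hT hB hI h.memY₁ h.memK₁ (σ := 1) (c := 1)
    (l := fun t => -Real.exp (2 * (T - t)) - ε) (m := fun t => -(2 * Real.exp (2 * (T - t))))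
    zero_le_one (by fun_prop) (by fun_prop)
    (fun s t => by rw [intervalIntegral.integral_neg, integral_mul_exp_sub]; ring)
    (ae_of_all _ fun ω r hr => by
      have h1 := le_max_left (1 * S.Y₁ r ω + (-Real.exp (2 * (T - r)) - ε)) 0
      have h2 := one_le_exp_mul_sub (T := T) zero_le_two hr
      linarith)
    (ae_of_all _ fun ω s _ t _ _ => by linarith)
    (by
      filter_upwards [h.skorokhod₁', h.memY₁.continuous_paths, h.memY₂.continuous_paths,
        h.le_Y₁, h.Y₂_le_exp hT hB] with ω h1 h2 h3 h4 h5
      refine h1.exists_flat (h2.sub h3) (fun t ht => sub_nonneg.2 (h4 t ht))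
        (D := fun s => 1 * S.Y₁ s ω + (-Real.exp (2 * (T - s)) - ε))
        ((h2.const_mul _).add (by fun_prop)) fun t ht hD => ?_
      have h6 := h5 t ht
      linarith)
    ((h.terminal₁ hT).mono fun ω hω => by
      rw [hω, sub_self, mul_zero, Real.exp_zero]
      linarith)
  filter_upwards [this] with ω hω t ht
  linarith [hω t ht]

/-- The common value follows the drift y, so `K₂` must absorb the excess (2 - 1)e^{T-t} dt of the
second equation. Both Skorokhod conditions are trivial since Y₁ = Y₂. -/
theorem isSolution_solMin [IsProbabilityMeasure P] (hT : 0 ≤ T) :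
    IsSolution P T B (dataS2 Ω d) (solMin Ω d T) := by
  have hK : Continuous fun t : ℝ => Real.exp T * (1 - Real.exp (-t)) := by fun_prop
  have hKm : Monotone fun t : ℝ => Real.exp T * (1 - Real.exp (-t)) := fun s t hst => by
    have : Real.exp (-t) ≤ Real.exp (-s) := Real.exp_le_exp.2 (neg_le_neg hst)
    exact mul_le_mul_of_nonneg_left (by linarith) (Real.exp_pos T).le
  have hK0 : Real.exp T * (1 - Real.exp (-0)) = 0 := by simp
  have hY : MemS2 P T B fun t _ => Real.exp (T - t) := memS2_deterministic (by fun_prop)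
  have hint := fun t => integral_mul_exp_sub (c := 1) T t T
  simp only [one_mul, sub_self, Real.exp_zero] at hint
  exact {
    memY₁ := hY
    memZ₁ := memM2_zero
    memK₁ := memA2_zero
    memY₂ := hY
    memZ₂ := memM2_zero
    memK₂ := memA2_deterministic hK hKm hK0
    drift₁ := ae_of_all _ fun ω =>
      (by fun_prop : Continuous fun s : ℝ => Real.exp (T - s)).intervalIntegrable _ _
    drift₂ := ae_of_all _ fun ω =>
      (by fun_prop : Continuous fun s : ℝ => 2 * Real.exp (T - s)).intervalIntegrable _ _
    eq₁ := ⟨fun _ _ => 0, isItoIntegral_zero hT, ae_of_all _ fun ω t ht => by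
      simp only [solMin, dataS2, hint]
      ring⟩
    eq₂ := ⟨fun _ _ => 0, isItoIntegral_zero hT, ae_of_all _ fun ω t ht => by
      simp only [solMin, dataS2, intervalIntegral.integral_const_mul, hint, mul_sub, mul_one,
        ← Real.exp_add, ← sub_eq_add_neg, sub_self, Real.exp_zero]
      ring⟩
    obstacle₁ := ae_of_all _ fun ω t ht => by simp [solMin, dataS2]
    obstacle₂ := ae_of_all _ fun ω t ht => by simp [solMin, dataS2]
    skorokhod₁ := ae_of_all _ fun ω => by
      simpa [solMin, dataS2] using
        stieltjesIntegralEqZero_zero (T := T) continuous_const (monotone_const (c := (0 : ℝ)))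
    skorokhod₂ := ae_of_all _ fun ω => by
      simpa [solMin, dataS2] using stieltjesIntegralEqZero_zero (T := T) hK hKm }

/-- Here the common value follows the drift 2y, and `K₁` supplies the missing (2 - 1)e^{2(T-t)} dt
of the first equation. -/
theorem isSolution_solMax [IsProbabilityMeasure P] (hT : 0 ≤ T) :
    IsSolution P T B (dataS2 Ω d) (solMax Ω d T) := by
  have hK : Continuous fun t : ℝ => 1 / 2 * Real.exp (2 * T) * (1 - Real.exp (-2 * t)) := by
    fun_prop
  have hKm : Monotone fun t : ℝ => 1 / 2 * Real.exp (2 * T) * (1 - Real.exp (-2 * t)) :=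
    fun s t hst => by
      have : Real.exp (-2 * t) ≤ Real.exp (-2 * s) := Real.exp_le_exp.2 (by linarith)
      exact mul_le_mul_of_nonneg_left (by linarith) (by positivity)
  have hK0 : 1 / 2 * Real.exp (2 * T) * (1 - Real.exp (-2 * 0)) = 0 := by simp
  have hY : MemS2 P T B fun t _ => Real.exp (2 * (T - t)) := memS2_deterministic (by fun_prop)
  have hint := fun t => integral_mul_exp_sub (c := 2) T t T
  simp only [sub_self, mul_zero, Real.exp_zero] at hint
  have hexp : ∀ t : ℝ, Real.exp (2 * T) * Real.exp (-2 * t) = Real.exp (2 * (T - t)) := fun t => by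
    rw [← Real.exp_add]
    ring_nf
  exact {
    memY₁ := hY
    memZ₁ := memM2_zero
    memK₁ := memA2_deterministic hK hKm hK0
    memY₂ := hY
    memZ₂ := memM2_zero
    memK₂ := memA2_zero
    drift₁ := ae_of_all _ fun ω =>
      (by fun_prop : Continuous fun s : ℝ => Real.exp (2 * (T - s))).intervalIntegrable _ _
    drift₂ := ae_of_all _ fun ω =>
      (by fun_prop : Continuous fun s : ℝ => 2 * Real.exp (2 * (T - s))).intervalIntegrable _ _
    eq₁ := ⟨fun _ _ => 0, isItoIntegral_zero hT, ae_of_all _ fun ω t ht => by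
      have h1 := hint t
      have h2 := hexp t
      have h3 := hexp T
      rw [intervalIntegral.integral_const_mul] at h1
      rw [sub_self, mul_zero, Real.exp_zero] at h3
      simp only [solMax, dataS2]
      linarith⟩
    eq₂ := ⟨fun _ _ => 0, isItoIntegral_zero hT, ae_of_all _ fun ω t ht => by
      simp only [solMax, dataS2, hint]
      ring⟩
    obstacle₁ := ae_of_all _ fun ω t ht => by simp [solMax, dataS2]
    obstacle₂ := ae_of_all _ fun ω t ht => by simp [solMax, dataS2]
    skorokhod₁ := ae_of_all _ fun ω => by
      simpa [solMax, dataS2] using stieltjesIntegralEqZero_zero (T := T) hK hKm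
    skorokhod₂ := ae_of_all _ fun ω => by
      simpa [solMax, dataS2] using
        stieltjesIntegralEqZero_zero (T := T) continuous_const (monotone_const (c := (0 : ℝ))) }

/-! ### Extremality and uniqueness of the extremal solutions. -/

theorem isMinimalSolution_solMin [IsProbabilityMeasure P] (hT : 0 ≤ T)
    (hB : IsBrownianMotionOn P T B) : IsMinimalSolution P T B (dataS2 Ω d) (solMin Ω d T) := by
  refine ⟨isSolution_solMin hT, fun S h => ?_⟩
  filter_upwards [h.exp_le_Y₁ hT hB, h.exp_le_Y₂ hT hB] with ω h1 h2 t ht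
  exact ⟨h1 t ht, h2 t ht⟩

theorem isMaximalSolution_solMax [IsProbabilityMeasure P] (hT : 0 ≤ T)
    (hB : IsBrownianMotionOn P T B) : IsMaximalSolution P T B (dataS2 Ω d) (solMax Ω d T) := by
  refine ⟨isSolution_solMax hT, fun S h => ?_⟩
  filter_upwards [h.Y₁_le_exp hT hB, h.Y₂_le_exp hT hB] with ω h1 h2 t ht
  exact ⟨h1 t ht, h2 t ht⟩

/-- Two minimal solutions bound each other, which fixes the `Y`-components; the exponential form
then fixes `Z` and `K`. With c = 1 the factor 1 - q/c is 0 for q = 1 and -1 for q = 2. -/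
theorem IsMinimalSolution.sameSextuple [IsProbabilityMeasure P] (hT : 0 ≤ T)
    (hB : IsBrownianMotionOn P T B) (h : IsMinimalSolution P T B (dataS2 Ω d) S) :
    SameSextuple P T S (solMin Ω d T) := by
  have hle := h.2 _ (isSolution_solMin hT)
  have hge := (isMinimalSolution_solMin hT hB).2 S h.1
  have hY₁ : IndistOn P T S.Y₁ (solMin Ω d T).Y₁ := by
    filter_upwards [hle, hge] with ω h1 h2 t ht
    exact le_antisymm (h1 t ht).1 (h2 t ht).1
  have hY₂ : IndistOn P T S.Y₂ (solMin Ω d T).Y₂ := by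
    filter_upwards [hle, hge] with ω h1 h2 t ht
    exact le_antisymm (h1 t ht).2 (h2 t ht).2
  obtain ⟨I₁, hI₁, hi₁⟩ := h.1.exists_increments₁
  obtain ⟨I₂, hI₂, hi₂⟩ := h.1.exists_increments₂
  obtain ⟨hZ₁, hK₁⟩ := hi₁.eq_of_eq_exp hT hB hI₁ h.1.memZ₁ h.1.memK₁ (by simp) one_pos
    (hY₁.mono fun ω hω t ht => by rw [hω t ht, one_mul]; rfl)
  obtain ⟨hZ₂, hK₂⟩ := hi₂.eq_of_eq_exp hT hB hI₂ h.1.memZ₂ h.1.memK₂ (by simp) one_pos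
    (hY₂.mono fun ω hω t ht => by rw [hω t ht, one_mul]; rfl)
  refine ⟨hY₁, hZ₁, ?_, hY₂, hZ₂, ?_⟩
  · filter_upwards [hK₁] with ω hω t ht
    simpa [solMin] using hω t ht
  · filter_upwards [hK₂] with ω hω t ht
    have h1 := hω t ht
    simp only [one_mul, div_one, sub_eq_add_neg T t, Real.exp_add] at h1
    simp only [solMin]
    linarith

theorem IsMaximalSolution.sameSextuple [IsProbabilityMeasure P] (hT : 0 ≤ T)
    (hB : IsBrownianMotionOn P T B) (h : IsMaximalSolution P T B (dataS2 Ω d) S) :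
    SameSextuple P T S (solMax Ω d T) := by
  have hge := h.2 _ (isSolution_solMax hT)
  have hle := (isMaximalSolution_solMax hT hB).2 S h.1
  have hY₁ : IndistOn P T S.Y₁ (solMax Ω d T).Y₁ := by
    filter_upwards [hle, hge] with ω h1 h2 t ht
    exact le_antisymm (h1 t ht).1 (h2 t ht).1
  have hY₂ : IndistOn P T S.Y₂ (solMax Ω d T).Y₂ := by
    filter_upwards [hle, hge] with ω h1 h2 t ht
    exact le_antisymm (h1 t ht).2 (h2 t ht).2
  obtain ⟨I₁, hI₁, hi₁⟩ := h.1.exists_increments₁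
  obtain ⟨I₂, hI₂, hi₂⟩ := h.1.exists_increments₂
  obtain ⟨hZ₁, hK₁⟩ := hi₁.eq_of_eq_exp hT hB hI₁ h.1.memZ₁ h.1.memK₁ (by simp) two_pos hY₁
  obtain ⟨hZ₂, hK₂⟩ := hi₂.eq_of_eq_exp hT hB hI₂ h.1.memZ₂ h.1.memK₂ (by simp) two_pos hY₂
  refine ⟨hY₁, hZ₁, ?_, hY₂, hZ₂, ?_⟩
  · filter_upwards [hK₁] with ω hω t ht
    have h1 := hω t ht
    rw [show 2 * (T - t) = 2 * T + -2 * t by ring, Real.exp_add] at h1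
    simp only [solMax]
    linarith
  · filter_upwards [hK₂] with ω hω t ht
    simpa [solMax] using hω t ht

end LinearSystem

theorem mainTheorem6 {Ω : Type*} [MeasurableSpace Ω] (P : Measure Ω) [IsProbabilityMeasure P]
    {d : ℕ} (T : ℝ) (hT : 0 < T) (B : ℝ → Ω → EuclideanSpace ℝ (Fin d))
    (hB : IsBrownianMotionOn P T B) :
    (IsMinimalSolution P T B (dataS2 Ω d) (solMin Ω d T) ∧
      ∀ S : Sextuple Ω d, IsMinimalSolution P T B (dataS2 Ω d) S →
        SameSextuple P T S (solMin Ω d T)) ∧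
    (IsMaximalSolution P T B (dataS2 Ω d) (solMax Ω d T) ∧
      ∀ S : Sextuple Ω d, IsMaximalSolution P T B (dataS2 Ω d) S →
        SameSextuple P T S (solMax Ω d T)) ∧
    (∃ S S' : Sextuple Ω d, IsSolution P T B (dataS2 Ω d) S ∧ IsSolution P T B (dataS2 Ω d) S' ∧
      ¬ IndistOn P T S.Y₁ S'.Y₁ ∧ ¬ IndistOn P T S.Y₂ S'.Y₂) := by

  -- The extremal solutions already differ at time 0, where T > 0 gives T ≠ 2T.
  have hne : Real.exp (T - 0) ≠ Real.exp (2 * (T - 0)) := by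
    rw [Ne, Real.exp_eq_exp]
    linarith
  refine ⟨⟨isMinimalSolution_solMin hT.le hB, fun S h => h.sameSextuple hT.le hB⟩,
    ⟨isMaximalSolution_solMax hT.le hB, fun S h => h.sameSextuple hT.le hB⟩,
    solMin Ω d T, solMax Ω d T, isSolution_solMin hT.le, isSolution_solMax hT.le, ?_, ?_⟩ <;>
  · intro h
    obtain ⟨ω, hω⟩ := h.exists
    exact hne (hω 0 (left_mem_Icc.2 hT.le))
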